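/- Let $-1<\rho<1$, $\theta\in\mathbb{R}$, $p\in\mathbb{R}$, $a\ge 0$, $b>0$, with $p>0$ if $a=0$. Let $\overline{K}_p(a,b)=(a/b)^pK_p(ab)$ if $a>0$ and $\overline{K}_p(0,b)=b^{-2p}\,\Gamma(p)\,2^{p-1}$, where $K_p$ is the modified Bessel function of the second kind. Let $\mathbf X=(X_1,X_2)^\top$ have the bivariate equi-skew generalised hyperbolic distribution $GH(0,R,(\theta,\theta)^\top,p,a,b)$, i.e. the law of $$(\theta,\theta)^\top W+\sqrt{W}\,\mathbf Z,$$ where $\mathbf Z\sim N(0,R)$, $R=\begin{pmatrix}1&\rho\\ \rho&1\end{pmatrix}$, is independent of $W\sim GIG(p,a,b)$, which has density $\frac{1}{2\overline{K}_p(a,b)}w^{p-1}\exp\left(-\frac12(a^2w^{-1}+b^2w)\right)$ for $w>0$. (The skew Variance Gamma distribution is the case $a=0$, $b=\sqrt{2/\nu}$, $p=\frac12$.) Let $F_1,F_2$ be the distribution functions of $X_1,X_2$, let $F_i^{-1}(u)=\inf\{x: u\le F_i(x)\}$, and let $C(u,v)=P(X_1\le F_1^{-1}(u),\,X_2\le F_2^{-1}(v))$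 be the copula of $\mathbf X$. Put $$\alpha=\sqrt{\tfrac{1-\rho}{1+\rho}},\quad \beta=\left(\theta^2(1+\alpha^2)+b^2\right)^{1/2},\quad \gamma=\beta+(1+\alpha^2)^{1/2}\theta,\quad \delta=(\theta^2+b^2)^{1/2}+\theta,$$ $$\tau=\frac{(1+\alpha^2)^{1/2}\gamma}{\delta},\qquad A^{-1}=2\,\overline{K}_p(a,b)\,(\theta^2+b^2)^{p/2}\,\delta,$$ $$C_1=\frac{(1+\alpha^2)^{\frac12(p-\frac32)}}{\sqrt{2\pi}\;\overline{K}_p(a,b)\,\beta^{p-\frac12}\,\alpha\,\gamma^2\,\delta^{p-\frac32}},\qquad C_2=A^{-\tau}\,\delta^{(p-1)\tau}.$$ Then $\tau>1$, and there is a function $L$ such that, for all $0<u<1$, $$C(u,u)=u^{\tau}L(u),\qquad\text{equivalently}\qquad \frac{C(u,u)}{u}=u^{\tau-1}L(u),$$ where $L$ is slowly varying at $0^+$ (it is positive and measurable on some interval $(0,c)$, and $L(\lambda u)/L(u)\to1$ as $u\to0^+$ for every $\lambda>0$) and $$L(u)\sim C_1C_2\,|\log u|^{(p-1)(1-\tau)-\frac12}\qquad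 (u\to0^+).$$ -/

import Mathlib

open MeasureTheory ProbabilityTheory Filter Topology Asymptotics

noncomputable section

/-- The modified Bessel function of the second kind `K_ν(x)`, `x > 0`, of real index `ν`, through
its integral representation `K_ν(x) = ∫₀^∞ e^{-x cosh t} cosh (ν t) dt`. -/
def besselK (ν x : ℝ) : ℝ :=
  ∫ t in Set.Ioi (0 : ℝ), Real.exp (-x * Real.cosh t) * Real.cosh (ν * t)

/-- The normalising function `K̄_p(a,b)` of the generalised inverse Gaussian density: the three
branches are used for `a = 0` (with `p, b > 0`), for `b = 0` (with `a > 0`, `p < 0`), and for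
`a, b > 0` (with `p` arbitrary). -/
def barK (p a b : ℝ) : ℝ :=
  if a = 0 then b ^ (-2 * p) * Real.Gamma p * (2 : ℝ) ^ (p - 1)
  else if b = 0 then a ^ (2 * p) * Real.Gamma (-p) * (2 : ℝ) ^ (-p - 1)
  else (a / b) ^ p * besselK p (a * b)

/-- The density of the generalised inverse Gaussian distribution `GIG(p,a,b)`. -/
def gigPDF (p a b w : ℝ) : ℝ :=
  if 0 < w then
    1 / (2 * barK p a b) * w ^ (p - 1) * Real.exp (-(1 / 2) * (a ^ 2 * w⁻¹ + b ^ 2 * w))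
  else 0

/-- The generalised inverse Gaussian distribution `GIG(p,a,b)`. -/
def gigMeasure (p a b : ℝ) : Measure ℝ :=
  volume.withDensity fun w => ENNReal.ofReal (gigPDF p a b w)

/-- The correlation matrix `R` with off-diagonal entry `ρ`. -/
def corrMatrix (ρ : ℝ) : Matrix (Fin 2) (Fin 2) ℝ := !![1, ρ; ρ, 1]

/-- The bivariate skew generalised hyperbolic distribution `GH(0,R,θ,p,a,b)`: the law of
`W θ + √W Z`, where `W ∼ GIG(p,a,b)` and `Z ∼ N(0,R)` are independent. The skew Variance Gamma
distribution is the case `p = 1/2`, `a = 0`, `b = √(2/ν)`. -/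
def skewGH (ρ : ℝ) (θ : EuclideanSpace ℝ (Fin 2)) (p a b : ℝ) :
    Measure (EuclideanSpace ℝ (Fin 2)) :=
  ((gigMeasure p a b).prod (multivariateGaussian 0 (corrMatrix ρ))).map
    fun q => q.1 • θ + √q.1 • q.2

/-- The quantile function `F⁻¹(u) = inf {x | u ≤ F(x)}` of a distribution on the line. -/
def quantile (μ : Measure ℝ) (u : ℝ) : ℝ := sInf {x : ℝ | u ≤ cdf μ x}

/-- The copula `C(u,v) = P(X₁ ≤ F₁⁻¹(u), X₂ ≤ F₂⁻¹(v))` of a bivariate random vector (with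
continuous margins). -/
def copula {Ω : Type*} [MeasurableSpace Ω] (P : Measure Ω) (X : Ω → EuclideanSpace ℝ (Fin 2))
    (u v : ℝ) : ℝ :=
  P.real {ω | X ω 0 ≤ quantile (P.map fun ω => X ω 0) u ∧
    X ω 1 ≤ quantile (P.map fun ω => X ω 1) v}

/-- `L` is slowly varying at `0⁺`: it is positive and measurable on some interval `(0,c)`, and
`L(lu)/L(u) → 1` as `u → 0⁺` for every `l > 0`. -/
def SlowlyVaryingAtZero (L : ℝ → ℝ) : Prop :=
  (∃ c : ℝ, 0 < c ∧ (∀ u ∈ Set.Ioo 0 c, 0 < L u) ∧ Measurable ((Set.Ioo 0 c).domRestrict L)) ∧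
    ∀ l : ℝ, 0 < l → Tendsto (fun u => L (l * u) / L u) (𝓝[>] 0) (𝓝 1)

namespace EquiSkewGH

def alpha (ρ : ℝ) : ℝ := √((1 - ρ) / (1 + ρ))

def beta (ρ θ b : ℝ) : ℝ := √(θ ^ 2 * (1 + alpha ρ ^ 2) + b ^ 2)

def gamma (ρ θ b : ℝ) : ℝ := beta ρ θ b + √(1 + alpha ρ ^ 2) * θ

def delta (θ b : ℝ) : ℝ := √(θ ^ 2 + b ^ 2) + θ

/-- The tail order `τ`. -/
def tau (ρ θ b : ℝ) : ℝ := √(1 + alpha ρ ^ 2) * gamma ρ θ b / delta θ b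

/-- The constant `A` of the marginal lower tail. -/
def constA (θ p a b : ℝ) : ℝ :=
  1 / (2 * barK p a b * (θ ^ 2 + b ^ 2) ^ (p / 2) * delta θ b)

def const1 (ρ θ p a b : ℝ) : ℝ :=
  (1 + alpha ρ ^ 2) ^ ((p - 3 / 2) / 2) /
    (√(2 * Real.pi) * barK p a b * beta ρ θ b ^ (p - 1 / 2) * alpha ρ * gamma ρ θ b ^ 2 *
      delta θ b ^ (p - 3 / 2))

def const2 (ρ θ p a b : ℝ) : ℝ :=
  constA θ p a b ^ (-tau ρ θ b) * delta θ b ^ ((p - 1) * tau ρ θ b)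

end EquiSkewGH

end

/-! Given W = w, the lower tail of one coordinate at -y and the joint lower tail at (-y, -y) are
Gaussian probabilities H(t) with t = (y + θw)/√w. Both kernels have a limit of t^k e^{s²t²/2} H(t)
as t → ∞: `gaussTail` with s = 1, k = 1, and `orthantTail` with s = √(1+α²), k = 2
(`orthantTail_mul_tendsto`).

Mixing over W is then a Laplace integral. With B² = θ²s² + b², the exponent s²(y+θw)²/(2w) + b²w/2
is minimal at w = ys/B, and w = y(s/B)eˣ turns it into exactly s²θy + sBy cosh x. The mixture
therefore behaves like a constant times y^{p-(k+1)/2} e^{-s(B+sθ)y} (`gigMixture_tendsto`); the term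
a²/w vanishes because w → ∞ at the saddle point.

For s = 1 this gives F(-y) ~ A y^{p-1} e^{-δy}. For s = √(1+α²) the joint tail is ~ C₁ (δy)^{p-3/2}
e^{-δτy}, because sγ = δτ. The margins agree and are continuous, so C(u,u) is the joint tail at the
y with F(-y) = u. Dividing by u^τ cancels the exponentials and leaves the power (p-1)(1-τ) - 1/2 of
y, where y ~ |log u|/δ (`tendsto_div_rpow_of_tails`). Slow variation of L is that of powers of |log
u|. -/

noncomputable section

/-! ### The Gaussian tail -/

/-- The upper tail of the standard normal distribution, written as a lower tail at `-z`. -/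
def gaussTail (z : ℝ) : ℝ := (gaussianReal 0 1).real (Set.Iic (-z))

lemma gaussTail_nonneg (z : ℝ) : 0 ≤ gaussTail z := measureReal_nonneg

lemma gaussTail_le_one (z : ℝ) : gaussTail z ≤ 1 := measureReal_le_one

lemma gaussTail_antitone : Antitone gaussTail := fun _ _ h =>
  measureReal_mono (Set.Iic_subset_Iic.2 (neg_le_neg h))

lemma gaussTail_measurable : Measurable gaussTail := gaussTail_antitone.measurable

lemma gaussTail_eq_integral (z : ℝ) :
    gaussTail z = ∫ x in Set.Iic (-z), (√(2 * Real.pi))⁻¹ * Real.exp (-x ^ 2 / 2) := by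
  rw [gaussTail, measureReal_def, gaussianReal_apply_eq_integral _ one_ne_zero,
    ENNReal.toReal_ofReal (integral_nonneg fun x => gaussianPDFReal_nonneg _ _ _)]
  simp [gaussianPDFReal]

/-- Substituting x = -z - r/z gives x²/2 = z²/2 + r + r²/(2z²). The remaining integrand is dominated
by e^{-r}, which yields both a bound uniform in z and the limit. -/
lemma gaussTail_mul_eq_integral {z : ℝ} (hz : 0 < z) :
    z * Real.exp (z ^ 2 / 2) * gaussTail z =
      (√(2 * Real.pi))⁻¹ * ∫ r in Set.Ioi (0 : ℝ), Real.exp (-r - r ^ 2 / (2 * z ^ 2)) := by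
  have him : (fun r : ℝ => -z - r / z) '' Set.Ici 0 = Set.Iic (-z) := by
    ext x
    simp only [Set.mem_image, Set.mem_Ici, Set.mem_Iic]
    constructor
    · rintro ⟨r, hr, rfl⟩
      have := div_nonneg hr hz.le
      linarith
    · intro hx
      refine ⟨z * (-z - x), mul_nonneg hz.le (by linarith), ?_⟩
      field_simp
      ring
  have hinj : Set.InjOn (fun r : ℝ => -z - r / z) (Set.Ici 0) := by
    intro r _ r' _ h
    have : r / z = r' / z := by simpa using h
    exact (div_left_inj' hz.ne').1 this
  have hd : ∀ r ∈ Set.Ici (0 : ℝ),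
      HasDerivWithinAt (fun r : ℝ => -z - r / z) (-(1 / z)) (Set.Ici 0) r := fun r _ =>
    (((hasDerivAt_id r).div_const z).const_sub (-z)).hasDerivWithinAt
  rw [gaussTail_eq_integral, ← him,
    integral_image_eq_integral_abs_deriv_smul measurableSet_Ici hd hinj,
    integral_Ici_eq_integral_Ioi, ← integral_const_mul, ← integral_const_mul]
  refine integral_congr_ae (Eventually.of_forall fun r => ?_)
  have hexp : Real.exp (z ^ 2 / 2) * Real.exp (-(-z - r / z) ^ 2 / 2) =
      Real.exp (-r - r ^ 2 / (2 * z ^ 2)) := by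
    rw [← Real.exp_add]
    congr 1
    field_simp
    ring
  simp only [smul_eq_mul, abs_neg, abs_of_pos (one_div_pos.2 hz)]
  rw [← hexp]
  field_simp

lemma gaussTail_mul_le {z : ℝ} (hz : 0 < z) :
    z * Real.exp (z ^ 2 / 2) * gaussTail z ≤ (√(2 * Real.pi))⁻¹ := by
  rw [gaussTail_mul_eq_integral hz]
  refine mul_le_of_le_one_right (by positivity) ?_
  rw [← integral_exp_neg_Ioi_zero]
  refine integral_mono_of_nonneg (Eventually.of_forall fun r => (Real.exp_pos _).le)
    (integrableOn_exp_neg_Ioi 0) (Eventually.of_forall fun r => Real.exp_le_exp.2 ?_)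
  have : 0 ≤ r ^ 2 / (2 * z ^ 2) := by positivity
  linarith

lemma gaussTail_mul_tendsto :
    Tendsto (fun z => z * Real.exp (z ^ 2 / 2) * gaussTail z) atTop (𝓝 (√(2 * Real.pi))⁻¹) := by
  have h : Tendsto (fun z : ℝ => ∫ r in Set.Ioi (0 : ℝ), Real.exp (-r - r ^ 2 / (2 * z ^ 2)))
      atTop (𝓝 (∫ r in Set.Ioi (0 : ℝ), Real.exp (-r))) := by
    refine tendsto_integral_filter_of_dominated_convergence (fun r => Real.exp (-r))
      (Eventually.of_forall fun z => by fun_prop) (Eventually.of_forall fun z =>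
        Eventually.of_forall fun r => ?_) (integrableOn_exp_neg_Ioi 0)
      (Eventually.of_forall fun r => ?_)
    · rw [Real.norm_eq_abs, Real.abs_exp, Real.exp_le_exp]
      have : 0 ≤ r ^ 2 / (2 * z ^ 2) := by positivity
      linarith
    · refine (Real.continuous_exp.tendsto _).comp ?_
      have : Tendsto (fun z : ℝ => r ^ 2 / (2 * z ^ 2)) atTop (𝓝 0) :=
        tendsto_const_nhds.div_atTop ((tendsto_pow_atTop two_ne_zero).const_mul_atTop two_pos)
      simpa using this.const_sub (-r)
  rw [integral_exp_neg_Ioi_zero] at h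
  have h2 := h.const_mul (√(2 * Real.pi))⁻¹
  rw [mul_one] at h2
  refine h2.congr' ?_
  filter_upwards [eventually_gt_atTop 0] with z hz using (gaussTail_mul_eq_integral hz).symm

/-! ### The lower orthant of the bivariate normal law -/

/-- The lower orthant probability `P(Z₁ ≤ -t, Z₂ ≤ -t)` of the bivariate normal law. -/
def orthantTail (ρ t : ℝ) : ℝ :=
  (multivariateGaussian 0 (corrMatrix ρ)).real {z | z 0 ≤ -t ∧ z 1 ≤ -t}

lemma corrMatrix_posSemidef {ρ : ℝ} (h1 : -1 < ρ) (h2 : ρ < 1) : (corrMatrix ρ).PosSemidef := by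
  refine Matrix.PosSemidef.of_dotProduct_mulVec_nonneg ?_ fun x => ?_
  · ext i j
    fin_cases i <;> fin_cases j <;> simp [corrMatrix]
  · simp only [corrMatrix, Matrix.mulVec, dotProduct, Fin.sum_univ_two, Matrix.of_apply,
      Matrix.cons_val_zero, Matrix.cons_val_one, Pi.star_apply, star_trivial]
    nlinarith [mul_nonneg (by linarith : 0 ≤ 1 + ρ) (sq_nonneg (x 0 + x 1)),
      mul_nonneg (by linarith : 0 ≤ 1 - ρ) (sq_nonneg (x 0 - x 1))]

/-- A bivariate normal pair with correlation `ρ` is a rotation of independent normals. -/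
lemma multivariateGaussian_corrMatrix_eq_map {ρ : ℝ} (h1 : -1 < ρ) (h2 : ρ < 1) :
    multivariateGaussian 0 (corrMatrix ρ) =
      ((gaussianReal 0 1).prod (gaussianReal 0 1)).map fun q : ℝ × ℝ =>
        (!₂[√((1 + ρ) / 2) * q.1 + √((1 - ρ) / 2) * q.2,
          √((1 + ρ) / 2) * q.1 - √((1 - ρ) / 2) * q.2] : EuclideanSpace ℝ (Fin 2)) := by
  have hm : Measurable fun q : ℝ × ℝ =>
      (!₂[√((1 + ρ) / 2) * q.1 + √((1 - ρ) / 2) * q.2,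
        √((1 + ρ) / 2) * q.1 - √((1 - ρ) / 2) * q.2] : EuclideanSpace ℝ (Fin 2)) := by
    fun_prop
  have := Measure.isProbabilityMeasure_map (μ := (gaussianReal 0 1).prod (gaussianReal 0 1))
    hm.aemeasurable
  -- Characteristic functions agree because (1+ρ)/2·(t₀+t₁)² + (1-ρ)/2·(t₀-t₁)² is the quadratic
  -- form of `corrMatrix ρ`.
  refine Measure.ext_of_charFun ?_
  ext t
  set a := √((1 + ρ) / 2) with ha
  set c := √((1 - ρ) / 2) with hc
  have ha2 : a ^ 2 = (1 + ρ) / 2 := Real.sq_sqrt (by linarith)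
  have hc2 : c ^ 2 = (1 - ρ) / 2 := Real.sq_sqrt (by linarith)
  rw [charFun_multivariateGaussian (corrMatrix_posSemidef h1 h2), charFun_apply,
    integral_map hm.aemeasurable (by fun_prop)]
  have hsplit : ∀ q : ℝ × ℝ, Complex.exp (((inner ℝ (!₂[a * q.1 + c * q.2, a * q.1 - c * q.2] :
      EuclideanSpace ℝ (Fin 2)) t : ℝ) : ℂ) * Complex.I) =
      Complex.exp (((a * (t 0 + t 1) : ℝ) : ℂ) * q.1 * Complex.I) *
        Complex.exp (((c * (t 0 - t 1) : ℝ) : ℂ) * q.2 * Complex.I) := by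
    intro q
    rw [← Complex.exp_add]
    congr 1
    simp [PiLp.inner_apply, Fin.sum_univ_two]
    ring
  simp_rw [hsplit]
  rw [integral_prod_mul (fun x : ℝ => Complex.exp (((a * (t 0 + t 1) : ℝ) : ℂ) * x * Complex.I))
    (fun x : ℝ => Complex.exp (((c * (t 0 - t 1) : ℝ) : ℂ) * x * Complex.I)),
    ← charFun_apply_real, ← charFun_apply_real, charFun_gaussianReal, charFun_gaussianReal,
    ← Complex.exp_add]
  congr 1
  have ha2' : (a : ℂ) ^ 2 = (1 + ρ) / 2 := by exact_mod_cast congrArg (Complex.ofReal) ha2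
  have hc2' : (c : ℂ) ^ 2 = (1 - ρ) / 2 := by exact_mod_cast congrArg (Complex.ofReal) hc2
  simp [corrMatrix, Matrix.mulVec, dotProduct, Fin.sum_univ_two, mul_pow, ha2', hc2']
  ring

lemma integral_exp_neg_mul_abs {c : ℝ} (hc : 0 < c) : ∫ r : ℝ, Real.exp (-c * |r|) = 2 / c := by
  rw [integral_comp_abs (f := fun r => Real.exp (-c * r)),
    integral_exp_mul_Ioi (neg_neg_of_pos hc) 0]
  simp
  ring

lemma integrable_exp_neg_mul_abs {c : ℝ} (hc : 0 < c) :
    Integrable fun r : ℝ => Real.exp (-c * |r|) := by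
  -- The integral of a non-integrable function is 0 by convention, and this one is 2/c ≠ 0.
  refine not_imp_comm.1 integral_undef ?_
  rw [integral_exp_neg_mul_abs hc]
  positivity

/-- The tail at T + c|v| carries a factor e^{-cT|v|}, so only v of order 1/T counts. After v = r/T
the integrand tends to e^{-c|r|}/(2π), whose integral is 1/(πc). -/
lemma gaussTail_mixture_tendsto {c : ℝ} (hc : 0 < c) :
    Tendsto (fun T => T ^ 2 * Real.exp (T ^ 2 / 2) *
      ∫ v, gaussTail (T + c * |v|) ∂gaussianReal 0 1) atTop (𝓝 (1 / (Real.pi * c))) := by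
  set k := (√(2 * Real.pi))⁻¹ with hk
  have hkpos : 0 < k := by positivity
  have hk2 : k * k = 1 / (2 * Real.pi) := by
    rw [hk, ← mul_inv, Real.mul_self_sqrt (by positivity), one_div]
  have key : ∀ {T : ℝ}, 0 < T → ∀ r : ℝ,
      T * Real.exp (T ^ 2 / 2) * (k * Real.exp (-(T⁻¹ * r) ^ 2 / 2) *
        gaussTail (T + c * |T⁻¹ * r|)) =
      k * Real.exp (-(T⁻¹ * r) ^ 2 / 2) * (T / (T + c * |T⁻¹ * r|)) *
        Real.exp (-c * |r| - c ^ 2 * (T⁻¹ * r) ^ 2 / 2) *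
        ((T + c * |T⁻¹ * r|) * Real.exp ((T + c * |T⁻¹ * r|) ^ 2 / 2) *
          gaussTail (T + c * |T⁻¹ * r|)) := by
    intro T hT r
    have hz : 0 < T + c * |T⁻¹ * r| := by positivity
    have he : Real.exp (T ^ 2 / 2) = Real.exp (-c * |r| - c ^ 2 * (T⁻¹ * r) ^ 2 / 2) *
        Real.exp ((T + c * |T⁻¹ * r|) ^ 2 / 2) := by
      rw [← Real.exp_add]
      congr 1
      have h1 : |T⁻¹ * r| ^ 2 = (T⁻¹ * r) ^ 2 := sq_abs _
      have h2 : T * |T⁻¹ * r| = |r| := by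
        rw [abs_mul, abs_of_pos (inv_pos.2 hT)]
        field_simp
      linear_combination -c * h2 - c ^ 2 / 2 * h1
    rw [he]
    field_simp
  have heq : (fun T => ∫ r : ℝ, T * Real.exp (T ^ 2 / 2) * (k * Real.exp (-(T⁻¹ * r) ^ 2 / 2) *
        gaussTail (T + c * |T⁻¹ * r|))) =ᶠ[atTop] fun T => T ^ 2 * Real.exp (T ^ 2 / 2) *
      ∫ v, gaussTail (T + c * |v|) ∂gaussianReal 0 1 := by
    filter_upwards [eventually_gt_atTop 0] with T hT
    rw [integral_const_mul, Measure.integral_comp_mul_left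
      (fun v => k * Real.exp (-v ^ 2 / 2) * gaussTail (T + c * |v|)),
      integral_gaussianReal_eq_integral_smul one_ne_zero, inv_inv, abs_of_pos hT]
    simp only [gaussianPDFReal, NNReal.coe_one, mul_one, sub_zero, smul_eq_mul, ← hk]
    ring
  refine Tendsto.congr' heq ?_
  have hlim : ∫ r : ℝ, k * k * Real.exp (-c * |r|) = 1 / (Real.pi * c) := by
    rw [integral_const_mul, integral_exp_neg_mul_abs hc, hk2]
    field_simp
  rw [← hlim]
  refine tendsto_integral_filter_of_dominated_convergence
    (fun r => k * k * Real.exp (-c * |r|)) (Eventually.of_forall fun T => ?_) ?_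
    ((integrable_exp_neg_mul_abs hc).const_mul _) (Eventually.of_forall fun r => ?_)
  · have := gaussTail_measurable
    exact Measurable.aestronglyMeasurable (by fun_prop)
  · filter_upwards [eventually_gt_atTop 0] with T hT
    refine Eventually.of_forall fun r => ?_
    have hz : 0 < T + c * |T⁻¹ * r| := by positivity
    have hb := gaussTail_mul_le hz
    have h0 := gaussTail_nonneg (T + c * |T⁻¹ * r|)
    rw [Real.norm_eq_abs, abs_of_nonneg (by positivity), key hT]
    have h1 : Real.exp (-(T⁻¹ * r) ^ 2 / 2) ≤ 1 := by
      rw [Real.exp_le_one_iff]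
      have := sq_nonneg (T⁻¹ * r)
      linarith
    have h2 : T / (T + c * |T⁻¹ * r|) ≤ 1 := by
      rw [div_le_one hz]
      have : 0 ≤ c * |T⁻¹ * r| := by positivity
      linarith
    have h3 : Real.exp (-c * |r| - c ^ 2 * (T⁻¹ * r) ^ 2 / 2) ≤ Real.exp (-c * |r|) := by
      rw [Real.exp_le_exp]
      have : 0 ≤ c ^ 2 * (T⁻¹ * r) ^ 2 / 2 := by positivity
      linarith
    calc _ ≤ k * 1 * 1 * Real.exp (-c * |r|) * k := by gcongr
      _ = _ := by ring
  · have hinv : Tendsto (fun T : ℝ => T⁻¹ * r) atTop (𝓝 0) := by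
      simpa using tendsto_inv_atTop_zero.mul_const r
    have hz : Tendsto (fun T : ℝ => T + c * |T⁻¹ * r|) atTop atTop :=
      tendsto_atTop_mono (fun T => le_add_of_nonneg_right (by positivity)) tendsto_id
    have hratio : Tendsto (fun T : ℝ => T / (T + c * |T⁻¹ * r|)) atTop (𝓝 1) := by
      have h : Tendsto (fun T : ℝ => 1 - c * |T⁻¹ * r| / (T + c * |T⁻¹ * r|)) atTop
          (𝓝 (1 - 0)) :=
        ((hinv.abs.const_mul c).div_atTop hz).const_sub 1
      rw [sub_zero] at h
      refine h.congr' ?_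
      filter_upwards [eventually_gt_atTop 0] with T hT
      have hz : T + c * |T⁻¹ * r| ≠ 0 := by positivity
      field_simp
      ring
    have h1 : Tendsto (fun T : ℝ => k * Real.exp (-(T⁻¹ * r) ^ 2 / 2)) atTop (𝓝 (k * 1)) := by
      refine Tendsto.const_mul _ ?_
      have := (Real.continuous_exp.tendsto _).comp (((hinv.pow 2).neg).div_const 2)
      simpa [Function.comp_def] using this
    have h3 : Tendsto (fun T : ℝ => Real.exp (-c * |r| - c ^ 2 * (T⁻¹ * r) ^ 2 / 2)) atTop
        (𝓝 (Real.exp (-c * |r|))) := by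
      refine (Real.continuous_exp.tendsto _).comp ?_
      have := (((hinv.pow 2).const_mul (c ^ 2)).div_const 2).const_sub (-c * |r|)
      simpa using this
    have h4 := gaussTail_mul_tendsto.comp hz
    have := ((h1.mul hratio).mul h3).mul h4
    rw [show k * 1 * 1 * Real.exp (-c * |r|) * k = k * k * Real.exp (-c * |r|) by ring] at this
    refine this.congr' ?_
    filter_upwards [eventually_gt_atTop 0] with T hT using (key hT r).symm

lemma one_add_alpha_sq {ρ : ℝ} (h1 : -1 < ρ) (h2 : ρ < 1) :
    1 + EquiSkewGH.alpha ρ ^ 2 = 2 / (1 + ρ) := by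
  have : 0 < 1 + ρ := by linarith
  rw [EquiSkewGH.alpha, Real.sq_sqrt (div_nonneg (by linarith) this.le)]
  field_simp
  ring

lemma alpha_pos {ρ : ℝ} (h1 : -1 < ρ) (h2 : ρ < 1) : 0 < EquiSkewGH.alpha ρ :=
  Real.sqrt_pos.2 (div_pos (by linarith) (by linarith))

/-- In the rotated coordinates both constraints together read √((1+ρ)/2)·U + √((1-ρ)/2)·|V| ≤ -t.
Dividing by the first coefficient produces √(1+α²) and α; then V is held fixed. -/
lemma orthantTail_eq_integral {ρ : ℝ} (h1 : -1 < ρ) (h2 : ρ < 1) (t : ℝ) :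
    orthantTail ρ t = ∫ v, gaussTail (√(1 + EquiSkewGH.alpha ρ ^ 2) * t +
      EquiSkewGH.alpha ρ * |v|) ∂gaussianReal 0 1 := by
  have hm : Measurable fun q : ℝ × ℝ =>
      (!₂[√((1 + ρ) / 2) * q.1 + √((1 - ρ) / 2) * q.2,
        √((1 + ρ) / 2) * q.1 - √((1 - ρ) / 2) * q.2] : EuclideanSpace ℝ (Fin 2)) := by
    fun_prop
  have hS : MeasurableSet {z : EuclideanSpace ℝ (Fin 2) | z 0 ≤ -t ∧ z 1 ≤ -t} :=
    measurableSet_setOfPred.2 (by fun_prop)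
  have hρ : 0 < 1 + ρ := by linarith
  have hs : √(1 + EquiSkewGH.alpha ρ ^ 2) = (√((1 + ρ) / 2))⁻¹ := by
    rw [one_add_alpha_sq h1 h2, ← Real.sqrt_inv, inv_div]
  have ha : EquiSkewGH.alpha ρ = (√((1 + ρ) / 2))⁻¹ * √((1 - ρ) / 2) := by
    rw [EquiSkewGH.alpha, ← Real.sqrt_inv, ← Real.sqrt_mul (by positivity)]
    congr 1
    field_simp
  rw [orthantTail, multivariateGaussian_corrMatrix_eq_map h1 h2, map_measureReal_apply hm hS,
    measureReal_def, Measure.prod_apply_symm (hm hS),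
    integral_eq_lintegral_of_nonneg_ae (Eventually.of_forall fun v => gaussTail_nonneg _)
      (gaussTail_measurable.comp (by fun_prop)).aestronglyMeasurable]
  congr 1
  refine lintegral_congr fun v => ?_
  rw [gaussTail, ofReal_measureReal]
  congr 1
  ext x
  have hapos : 0 < √((1 + ρ) / 2) := Real.sqrt_pos.2 (by linarith)
  have hc0 : 0 ≤ √((1 - ρ) / 2) := Real.sqrt_nonneg _
  simp only [Set.mem_preimage, Set.mem_ofPred_eq, Set.mem_Iic, hs]
  simp only [ha, Matrix.cons_val_zero, Matrix.cons_val_one]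
  generalize √((1 + ρ) / 2) = A at *
  generalize √((1 - ρ) / 2) = B at *
  have e : x ≤ -(A⁻¹ * t + A⁻¹ * B * |v|) ↔ A * x + B * |v| ≤ -t := by
    rw [show -(A⁻¹ * t + A⁻¹ * B * |v|) = (-t - B * |v|) / A by field_simp; ring,
      le_div_iff₀ hapos]
    constructor <;> intro h <;> linarith
  rw [e]
  constructor
  · rintro ⟨u1, u2⟩
    rcases abs_cases v with ⟨h, _⟩ | ⟨h, _⟩ <;> rw [h] <;> linarith
  · intro h
    have p1 := mul_le_mul_of_nonneg_left (le_abs_self v) hc0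
    have p2 := mul_le_mul_of_nonneg_left (neg_abs_le v) hc0
    constructor <;> linarith

lemma orthantTail_mul_tendsto {ρ : ℝ} (h1 : -1 < ρ) (h2 : ρ < 1) :
    Tendsto (fun t => t ^ 2 * Real.exp ((1 + EquiSkewGH.alpha ρ ^ 2) * t ^ 2 / 2) *
      orthantTail ρ t) atTop
      (𝓝 (1 / (Real.pi * EquiSkewGH.alpha ρ * (1 + EquiSkewGH.alpha ρ ^ 2)))) := by
  have hs : 0 < 1 + EquiSkewGH.alpha ρ ^ 2 := by positivity
  have hT : Tendsto (fun t => √(1 + EquiSkewGH.alpha ρ ^ 2) * t) atTop atTop :=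
    tendsto_id.const_mul_atTop (Real.sqrt_pos.2 hs)
  have h := ((gaussTail_mixture_tendsto (alpha_pos h1 h2)).comp hT).const_mul
    (1 + EquiSkewGH.alpha ρ ^ 2)⁻¹
  rw [show (1 + EquiSkewGH.alpha ρ ^ 2)⁻¹ * (1 / (Real.pi * EquiSkewGH.alpha ρ)) =
    1 / (Real.pi * EquiSkewGH.alpha ρ * (1 + EquiSkewGH.alpha ρ ^ 2)) by
      have := alpha_pos h1 h2; field_simp] at h
  refine h.congr fun t => ?_
  simp only [Function.comp_apply, mul_pow, Real.sq_sqrt hs.le, orthantTail_eq_integral h1 h2]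
  field_simp

/-! ### The integrand around the saddle point -/

lemma cosh_sub_one_eq (x : ℝ) : Real.cosh x - 1 = 2 * Real.sinh (x / 2) ^ 2 := by
  have h := Real.cosh_two_mul (x / 2)
  rw [mul_div_cancel₀ x two_ne_zero, Real.cosh_sq] at h
  linarith

lemma half_sq_le_cosh_sub_one (x : ℝ) : x ^ 2 / 2 ≤ Real.cosh x - 1 := by
  have h1 : |x| / 2 ≤ Real.sinh (|x| / 2) := Real.self_le_sinh_iff.2 (by positivity)
  have h2 := pow_le_pow_left₀ (by positivity) h1 2
  rw [← Real.cosh_abs, cosh_sub_one_eq]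
  rw [div_pow, sq_abs] at h2
  linarith

/-- The quantity is 2(n sinh(r/(2n)))², and n sinh(r/(2n)) is a difference quotient at 0. -/
lemma sq_mul_cosh_div_sub_one_tendsto (r : ℝ) :
    Tendsto (fun n : ℝ => n ^ 2 * (Real.cosh (r / n) - 1)) atTop (𝓝 (r ^ 2 / 2)) := by
  have hd : HasDerivAt (fun z : ℝ => Real.sinh (r / 2 * z)) (r / 2) 0 := by
    simpa using ((hasDerivAt_id (0 : ℝ)).const_mul (r / 2)).sinh
  rw [hasDerivAt_iff_tendsto_slope_zero] at hd
  have hinv : Tendsto (fun n : ℝ => n⁻¹) atTop (𝓝[≠] 0) :=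
    tendsto_inv_atTop_nhdsGT_zero.mono_right (nhdsWithin_mono _ fun x hx => ne_of_gt hx)
  have h := ((hd.comp hinv).pow 2).const_mul 2
  rw [show 2 * (r / 2) ^ 2 = r ^ 2 / 2 by ring] at h
  refine h.congr fun n => ?_
  rw [cosh_sub_one_eq, show r / n / 2 = r / 2 * n⁻¹ by ring]
  simp
  ring

/-- The argument `(y + θ w) / √w` of the mixing kernel, divided by `√y`, at the point
`w = y (s / B) eˣ`. -/
def mixScale (s B θ x : ℝ) : ℝ :=
  (1 + θ * (s / B * Real.exp x)) / √(s / B * Real.exp x)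

/-- The mixing kernel at `w = y (s / B) eˣ`, `y = n²`, rescaled by its size at the saddle point
`x = 0`. -/
def mixKernel (k : ℕ) (H : ℝ → ℝ) (s b θ B n x : ℝ) : ℝ :=
  n ^ k * Real.exp (s * (B + s * θ) * n ^ 2 - b ^ 2 / 2 * (n ^ 2 * (s / B * Real.exp x))) *
    H (n * mixScale s B θ x)

section Kernel

variable {H : ℝ → ℝ} {k : ℕ} {c s b θ B : ℝ}

/-- Since B² = θ²s² + b², expanding the square leaves s²y²/(2w) + B²w/2 besides a term constant in
w. At w = y(s/B)eˣ the two summands are sBy e^{∓x}/2, hence the exact cosh. -/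
lemma mixKernel_exponent (hs : 0 < s) (hB : 0 < B) (hB2 : B ^ 2 = θ ^ 2 * s ^ 2 + b ^ 2)
    (n x : ℝ) :
    s * (B + s * θ) * n ^ 2 - b ^ 2 / 2 * (n ^ 2 * (s / B * Real.exp x)) =
      s ^ 2 * (n * mixScale s B θ x) ^ 2 / 2 - s * B * (n ^ 2 * (Real.cosh x - 1)) := by
  have hb2 : b ^ 2 = B ^ 2 - θ ^ 2 * s ^ 2 := by linarith
  have hE := Real.exp_pos x
  have hv : 0 ≤ s / B * Real.exp x := by positivity
  rw [mixScale, mul_pow, div_pow, Real.sq_sqrt hv, Real.cosh_eq, Real.exp_neg, hb2]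
  field_simp
  ring

lemma mixKernel_eq (hs : 0 < s) (hB : 0 < B) (hB2 : B ^ 2 = θ ^ 2 * s ^ 2 + b ^ 2) (n x : ℝ) :
    mixKernel k H s b θ B n x = n ^ k * Real.exp (s ^ 2 * (n * mixScale s B θ x) ^ 2 / 2) *
      H (n * mixScale s B θ x) * Real.exp (-(s * B) * (n ^ 2 * (Real.cosh x - 1))) := by
  rw [mixKernel, mixKernel_exponent hs hB hB2, sub_eq_add_neg, Real.exp_add, neg_mul]
  ring

lemma abs_lt_of_sq_eq (hb : 0 < b) (hB : 0 < B) (hB2 : B ^ 2 = θ ^ 2 * s ^ 2 + b ^ 2) :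
    0 < B + s * θ := by
  have h : |s * θ| < B := by
    rw [← abs_of_pos hB, ← sq_lt_sq, hB2]
    have := pow_pos hb 2
    nlinarith
  have := (abs_lt.1 h).1
  linarith

lemma mixScale_zero_pos (hs : 0 < s) (hb : 0 < b) (hB : 0 < B)
    (hB2 : B ^ 2 = θ ^ 2 * s ^ 2 + b ^ 2) : 0 < mixScale s B θ 0 := by
  have h := abs_lt_of_sq_eq hb hB hB2
  rw [mixScale, Real.exp_zero, mul_one]
  refine div_pos ?_ (Real.sqrt_pos.2 (div_pos hs hB))
  rw [show 1 + θ * (s / B) = (B + s * θ) / B by field_simp]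
  exact div_pos h hB

lemma continuousAt_mixScale (hs : 0 < s) (hB : 0 < B) : ContinuousAt (mixScale s B θ) 0 := by
  unfold mixScale
  refine ContinuousAt.div (by fun_prop) (by fun_prop) ?_
  have : 0 < s / B * Real.exp 0 := by positivity
  exact (Real.sqrt_pos.2 this).ne'

/-- The exponent in the region where the argument of the kernel is negative. -/
lemma exponent_le_of_mixScale_neg (hs : 0 < s) (hb : 0 < b) (hB : 0 < B)
    (hB2 : B ^ 2 = θ ^ 2 * s ^ 2 + b ^ 2) {n x : ℝ} (hneg : mixScale s B θ x < 0) :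
    s * (B + s * θ) * n ^ 2 - b ^ 2 / 2 * (n ^ 2 * (s / B * Real.exp x)) ≤
      -((B + s * θ) ^ 2 * (s / B) / 2) * (n ^ 2 * (Real.cosh x - 1)) := by
  have hγ := abs_lt_of_sq_eq hb hB hB2
  set v := s / B * Real.exp x with hv
  have hvpos : 0 < v := by positivity
  have h1 : 1 + θ * v < 0 := by
    by_contra h
    exact absurd hneg (not_lt.2 (div_nonneg (not_lt.1 h) (Real.sqrt_nonneg _)))
  have hsB : 0 < s / B := by positivity
  have h2 : 0 < 1 + θ * (s / B) := by
    rw [show 1 + θ * (s / B) = (B + s * θ) / B by field_simp]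
    exact div_pos hγ hB
  have hθ : θ < 0 := by
    by_contra h
    nlinarith [mul_nonneg (not_lt.1 h) hvpos.le]
  -- `1 + θ v` is negative at v and positive at s/B while θ < 0, so v > s/B.
  have hx : 0 ≤ x := by
    have h3 : s / B < v := by nlinarith
    rw [← Real.one_le_exp_iff]
    by_contra h
    have : v < s / B * 1 := mul_lt_mul_of_pos_left (not_le.1 h) hsB
    linarith
  have hcosh : Real.cosh x - 1 ≤ Real.exp x := by
    rw [Real.cosh_eq]
    have : Real.exp (-x) ≤ 1 := Real.exp_le_one_iff.2 (by linarith)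
    have := Real.exp_pos x
    linarith
  -- With γ = B + sθ one has γ² - b² = 2sθγ, so left side minus right side is sγ(1 + θv) < 0.
  have h4 : s * (B + s * θ) - b ^ 2 / 2 * v ≤ -((B + s * θ) ^ 2 / 2) * v := by
    have hb2 : b ^ 2 = B ^ 2 - θ ^ 2 * s ^ 2 := by linarith
    have h5 : 0 ≤ s * (B + s * θ) * (-(1 + θ * v)) :=
      mul_nonneg (mul_pos hs hγ).le (by linarith)
    rw [hb2]
    linear_combination h5
  have h6 : (B + s * θ) ^ 2 / 2 * ((s / B) * (Real.cosh x - 1)) ≤ (B + s * θ) ^ 2 / 2 * v := by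
    gcongr
    exact mul_le_mul_of_nonneg_left hcosh hsB.le
  have h7 := mul_le_mul_of_nonneg_left (h4.trans (by linarith :
    -((B + s * θ) ^ 2 / 2) * v ≤ -((B + s * θ) ^ 2 / 2 * ((s / B) * (Real.cosh x - 1)))))
    (sq_nonneg n)
  linear_combination h7

/-- Away from x = 0 the quantity cosh x - 1 is at least δ²/2, so half of the exponential absorbs the
power of n. -/
lemma exists_forall_pow_mul_exp_le {κ δ : ℝ} (hκ : 0 < κ) (hδ : 0 < δ) (k : ℕ) :
    ∃ C, 0 ≤ C ∧ ∀ n x : ℝ, 1 ≤ n → δ ≤ |x| →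
      n ^ k * Real.exp (-κ * (n ^ 2 * (Real.cosh x - 1))) ≤
        C * Real.exp (-(κ / 2) * (n ^ 2 * (Real.cosh x - 1))) := by
  set q := κ / 2 * (δ ^ 2 / 2) with hq
  have hqpos : 0 < q := by positivity
  refine ⟨k.factorial / q ^ k, by positivity, fun n x hn hx => ?_⟩
  have h1 : δ ^ 2 / 2 ≤ Real.cosh x - 1 := by
    refine le_trans ?_ (half_sq_le_cosh_sub_one x)
    rw [← sq_abs x]
    gcongr
  have h2 : (q * n) ^ k / k.factorial ≤ Real.exp (q * n) :=
    Real.pow_div_factorial_le_exp _ (by positivity) k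
  have h3 : Real.exp (q * n) ≤ Real.exp (κ / 2 * (n ^ 2 * (Real.cosh x - 1))) := by
    refine Real.exp_le_exp.2 ?_
    have h4 : n ≤ n ^ 2 := by nlinarith
    have h5 : n * (δ ^ 2 / 2) ≤ n ^ 2 * (Real.cosh x - 1) := by gcongr
    calc q * n = κ / 2 * (n * (δ ^ 2 / 2)) := by rw [hq]; ring
      _ ≤ _ := by gcongr
  have h6 : n ^ k ≤ k.factorial / q ^ k *
      Real.exp (κ / 2 * (n ^ 2 * (Real.cosh x - 1))) := by
    have h7 := h2.trans h3
    rw [mul_pow, div_le_iff₀ (by positivity)] at h7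
    rw [div_mul_eq_mul_div, le_div_iff₀ (by positivity)]
    linarith
  calc _ ≤ k.factorial / q ^ k * Real.exp (κ / 2 * (n ^ 2 * (Real.cosh x - 1))) *
        Real.exp (-κ * (n ^ 2 * (Real.cosh x - 1))) := by gcongr
    _ = _ := by
      rw [mul_assoc, ← Real.exp_add]
      congr 2
      ring

lemma exists_gauss_bound (h1 : ∀ t, H t ≤ 1)
    (hlim : Tendsto (fun t => t ^ k * Real.exp (s ^ 2 * t ^ 2 / 2) * H t) atTop (𝓝 c)) :
    ∃ M, 0 ≤ M ∧ ∀ t, 0 ≤ t → t ^ k * Real.exp (s ^ 2 * t ^ 2 / 2) * H t ≤ M := by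
  obtain ⟨T, hT⟩ := eventually_atTop.1 (hlim.eventually (eventually_le_nhds (lt_add_one c)))
  refine ⟨max |c + 1| (|T| ^ k * Real.exp (s ^ 2 * |T| ^ 2 / 2)), by positivity, fun t ht => ?_⟩
  rcases le_or_gt T t with h | h
  · exact (hT t h).trans ((le_abs_self _).trans (le_max_left _ _))
  · refine le_trans ?_ (le_max_right _ _)
    have htT : t ≤ |T| := h.le.trans (le_abs_self T)
    calc _ ≤ t ^ k * Real.exp (s ^ 2 * t ^ 2 / 2) :=
          mul_le_of_le_one_right (by positivity) (h1 t)
      _ ≤ _ := by gcongr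

/-- Three regimes. Near x = 0 the argument of H is at least nm, and the decay of H pays for n^k.
Farther out with a nonnegative argument, e^{s²t²/2}H(t) is merely bounded; with a negative one, H ≤
1 and `exponent_le_of_mixScale_neg` supplies the decay. In the last two, n^k costs half of the rate
κ. -/
lemma mixKernel_bound (h0 : ∀ t, 0 ≤ H t) (h1 : ∀ t, H t ≤ 1) (hs : 0 < s) (hb : 0 < b)
    (hB : 0 < B) (hB2 : B ^ 2 = θ ^ 2 * s ^ 2 + b ^ 2)
    (hlim : Tendsto (fun t => t ^ k * Real.exp (s ^ 2 * t ^ 2 / 2) * H t) atTop (𝓝 c)) :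
    ∃ C κ, 0 < κ ∧ 0 ≤ C ∧ ∀ n x : ℝ, 1 ≤ n →
      mixKernel k H s b θ B n x ≤ C * Real.exp (-κ * (n ^ 2 * (Real.cosh x - 1))) := by
  obtain ⟨M, hM0, hM⟩ := exists_gauss_bound h1 hlim
  obtain ⟨M', hM0', hM'⟩ : ∃ M, 0 ≤ M ∧ ∀ t, 0 ≤ t → Real.exp (s ^ 2 * t ^ 2 / 2) * H t ≤ M := by
    refine ⟨max (Real.exp (s ^ 2 * 1 ^ 2 / 2)) M, by positivity, fun t ht => ?_⟩
    rcases le_or_gt 1 t with h | h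
    · refine le_trans ?_ ((hM t ht).trans (le_max_right _ _))
      have h2 : 1 ≤ t ^ k := one_le_pow₀ h
      have h3 : 0 ≤ Real.exp (s ^ 2 * t ^ 2 / 2) * H t := mul_nonneg (by positivity) (h0 t)
      nlinarith
    · refine le_trans ?_ (le_max_left _ _)
      calc _ ≤ Real.exp (s ^ 2 * t ^ 2 / 2) := mul_le_of_le_one_right (by positivity) (h1 t)
        _ ≤ _ := by gcongr
  have hh := mixScale_zero_pos (θ := θ) hs hb hB hB2
  set m := mixScale s B θ 0 / 2 with hm
  have hmpos : 0 < m := by positivity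
  obtain ⟨δ, hδ, hball⟩ := Metric.eventually_nhds_iff.1
    ((continuousAt_mixScale (θ := θ) hs hB).eventually (lt_mem_nhds (half_lt_self hh)))
  have hγ := abs_lt_of_sq_eq hb hB hB2
  set κ := min (s * B) ((B + s * θ) ^ 2 * (s / B) / 2) with hκ
  have hκpos : 0 < κ := lt_min (by positivity) (by positivity)
  obtain ⟨C, hC0, hC⟩ := exists_forall_pow_mul_exp_le hκpos hδ k
  refine ⟨max (M / m ^ k) (max M' 1 * C), κ / 2, by positivity, by positivity, fun n x hn => ?_⟩
  have hn0 : 0 < n := by linarith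
  have hg : 0 ≤ n ^ 2 * (Real.cosh x - 1) :=
    mul_nonneg (sq_nonneg n) (by linarith [Real.one_le_cosh x])
  rcases lt_or_ge |x| δ with hx | hx
  · have hx' : m < mixScale s B θ x := hball (by simpa using hx)
    have ht : 0 ≤ n * mixScale s B θ x := (mul_pos hn0 (hmpos.trans hx')).le
    rw [mixKernel_eq hs hB hB2]
    have e1 : Real.exp (-(s * B) * (n ^ 2 * (Real.cosh x - 1))) ≤
        Real.exp (-(κ / 2) * (n ^ 2 * (Real.cosh x - 1))) := by
      refine Real.exp_le_exp.2 (mul_le_mul_of_nonneg_right ?_ hg)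
      have := min_le_left (s * B) ((B + s * θ) ^ 2 * (s / B) / 2)
      linarith
    have e2 : n ^ k * Real.exp (s ^ 2 * (n * mixScale s B θ x) ^ 2 / 2) *
        H (n * mixScale s B θ x) ≤ M / m ^ k := by
      rw [le_div_iff₀ (by positivity)]
      refine le_trans ?_ (hM _ ht)
      have e3 : n ^ k * m ^ k ≤ (n * mixScale s B θ x) ^ k := by
        rw [← mul_pow]
        gcongr
      have e4 : 0 ≤ Real.exp (s ^ 2 * (n * mixScale s B θ x) ^ 2 / 2) *
        H (n * mixScale s B θ x) := mul_nonneg (by positivity) (h0 _)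
      nlinarith
    exact mul_le_mul (e2.trans (le_max_left _ _)) e1 (by positivity) (by positivity)
  · refine le_trans ?_ (mul_le_mul_of_nonneg_right (le_max_right _ _) (Real.exp_pos _).le)
    rw [mul_assoc]
    refine le_trans ?_ (mul_le_mul_of_nonneg_left (hC n x hn hx) (by positivity))
    rcases lt_or_ge (mixScale s B θ x) 0 with ht | ht
    · have e1 := exponent_le_of_mixScale_neg (n := n) hs hb hB hB2 ht
      have e2 : -((B + s * θ) ^ 2 * (s / B) / 2) * (n ^ 2 * (Real.cosh x - 1)) ≤
          -κ * (n ^ 2 * (Real.cosh x - 1)) :=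
        mul_le_mul_of_nonneg_right (neg_le_neg (min_le_right _ _)) hg
      calc mixKernel k H s b θ B n x ≤ n ^ k * Real.exp (-κ * (n ^ 2 * (Real.cosh x - 1))) * 1 :=
            mul_le_mul (mul_le_mul_of_nonneg_left (Real.exp_le_exp.2 (e1.trans e2))
              (by positivity)) (h1 _) (h0 _) (by positivity)
        _ ≤ _ := by
          rw [mul_comm]
          exact mul_le_mul_of_nonneg_right (le_max_right _ _) (by positivity)
    · have e1 : Real.exp (-(s * B) * (n ^ 2 * (Real.cosh x - 1))) ≤
          Real.exp (-κ * (n ^ 2 * (Real.cosh x - 1))) :=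
        Real.exp_le_exp.2 (mul_le_mul_of_nonneg_right (neg_le_neg (min_le_left _ _)) hg)
      have e2 := hM' _ (mul_nonneg hn0.le ht)
      rw [mixKernel_eq hs hB hB2]
      calc _ = n ^ k * (Real.exp (s ^ 2 * (n * mixScale s B θ x) ^ 2 / 2) *
            H (n * mixScale s B θ x)) *
              Real.exp (-(s * B) * (n ^ 2 * (Real.cosh x - 1))) := by ring
        _ ≤ n ^ k * M' * Real.exp (-κ * (n ^ 2 * (Real.cosh x - 1))) := by gcongr
        _ = M' * (n ^ k * Real.exp (-κ * (n ^ 2 * (Real.cosh x - 1)))) := by ring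
        _ ≤ _ := mul_le_mul_of_nonneg_right (le_max_left _ _) (by positivity)

lemma mixKernel_tendsto (hs : 0 < s) (hb : 0 < b) (hB : 0 < B)
    (hB2 : B ^ 2 = θ ^ 2 * s ^ 2 + b ^ 2)
    (hlim : Tendsto (fun t => t ^ k * Real.exp (s ^ 2 * t ^ 2 / 2) * H t) atTop (𝓝 c)) (r : ℝ) :
    Tendsto (fun n => mixKernel k H s b θ B n (r / n)) atTop
      (𝓝 (c / mixScale s B θ 0 ^ k * Real.exp (-(s * B / 2) * r ^ 2))) := by
  have hh := mixScale_zero_pos (θ := θ) hs hb hB hB2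
  have hx : Tendsto (fun n : ℝ => r / n) atTop (𝓝 0) := tendsto_const_nhds.div_atTop tendsto_id
  have hsc : Tendsto (fun n : ℝ => mixScale s B θ (r / n)) atTop (𝓝 (mixScale s B θ 0)) :=
    (continuousAt_mixScale hs hB).tendsto.comp hx
  have ht : Tendsto (fun n : ℝ => n * mixScale s B θ (r / n)) atTop atTop :=
    tendsto_id.atTop_mul_pos hh hsc
  have h1 := (hlim.comp ht).div (hsc.pow k) (pow_pos hh k).ne'
  have h2 := (Real.continuous_exp.tendsto _).comp
    ((sq_mul_cosh_div_sub_one_tendsto r).const_mul (-(s * B)))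
  have h3 := h1.mul h2
  rw [show -(s * B) * (r ^ 2 / 2) = -(s * B / 2) * r ^ 2 by ring] at h3
  refine h3.congr' ?_
  filter_upwards [hsc.eventually (lt_mem_nhds hh)] with n hn
  rw [mixKernel_eq hs hB hB2]
  simp only [Function.comp_apply, Pi.div_apply, mul_pow]
  field_simp

end Kernel

/-! ### Laplace asymptotics of the mixture -/

/-- Logarithmic coordinate centred at the saddle point A and stretched to the fluctuation scale 1/n.
-/
lemma integral_Ioi_comp_exp {A n : ℝ} (hA : 0 < A) (hn : 0 < n) (g : ℝ → ℝ) :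
    ∫ w in Set.Ioi (0 : ℝ), g w =
      ∫ r : ℝ, A * Real.exp (r / n) / n * g (A * Real.exp (r / n)) := by
  have him : (fun r : ℝ => A * Real.exp (r / n)) '' Set.univ = Set.Ioi 0 := by
    ext w
    simp only [Set.image_univ, Set.mem_range, Set.mem_Ioi]
    constructor
    · rintro ⟨r, rfl⟩
      positivity
    · intro hw
      refine ⟨n * Real.log (w / A), ?_⟩
      rw [mul_div_cancel_left₀ _ hn.ne', Real.exp_log (div_pos hw hA)]
      field_simp
  have hinj : Set.InjOn (fun r : ℝ => A * Real.exp (r / n)) Set.univ := by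
    intro r _ r' _ h
    have h2 := Real.exp_injective (mul_left_cancel₀ hA.ne' h)
    exact (div_left_inj' hn.ne').1 h2
  have hd : ∀ r ∈ (Set.univ : Set ℝ), HasDerivWithinAt (fun r : ℝ => A * Real.exp (r / n))
      (A * Real.exp (r / n) / n) Set.univ r := fun r _ => by
    have := ((((hasDerivAt_id r).div_const n).exp).const_mul A).hasDerivWithinAt (s := Set.univ)
    simpa [div_eq_mul_inv, mul_assoc] using this
  rw [← him, integral_image_eq_integral_abs_deriv_smul MeasurableSet.univ hd hinj,
    setIntegral_univ]
  refine integral_congr_ae (Eventually.of_forall fun r => ?_)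
  have : 0 < A * Real.exp (r / n) / n := by positivity
  simp only [abs_of_pos this, smul_eq_mul]

/-- The integral of `H((y + θ W) / √W)` against the unnormalised density of `GIG(p,a,b)`. -/
def gigMixture (p a b θ : ℝ) (H : ℝ → ℝ) (y : ℝ) : ℝ :=
  ∫ w in Set.Ioi (0 : ℝ), w ^ (p - 1) * Real.exp (-(1 / 2) * (a ^ 2 * w⁻¹ + b ^ 2 * w)) *
    H ((y + θ * w) / √w)

section Mixture

variable {H : ℝ → ℝ} {k : ℕ} {c s b θ B : ℝ}

/-- Here y = n². The extra factor n in n^(k+1) undoes the 1/n of the Jacobian, and (n²)^(-p) cancels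
the y^p coming from w^(p-1) dw. -/
lemma gigMixture_sq_eq (p a : ℝ) (hs : 0 < s) (hB : 0 < B) {n : ℝ} (hn : 0 < n) :
    n ^ (k + 1) * (n ^ 2) ^ (-p) * Real.exp (s * (B + s * θ) * n ^ 2) *
        gigMixture p a b θ H (n ^ 2) =
      ∫ r : ℝ, (s / B) ^ p * Real.exp (p * (r / n)) *
        Real.exp (-(a ^ 2 / 2) * (n ^ 2 * (s / B) * Real.exp (r / n))⁻¹) *
          mixKernel k H s b θ B n (r / n) := by
  have hv : 0 < s / B := by positivity
  rw [gigMixture, integral_Ioi_comp_exp (A := n ^ 2 * (s / B)) (by positivity) hn,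
    ← integral_const_mul]
  refine integral_congr_ae (Eventually.of_forall fun r => ?_)
  simp only
  set w := n ^ 2 * (s / B) * Real.exp (r / n) with hw
  have hwpos : 0 < w := by positivity
  have hwn : w = n ^ 2 * (s / B * Real.exp (r / n)) := by rw [hw]; ring
  have e2 : w ^ (p - 1) = (n ^ 2) ^ p * ((s / B) ^ p * Real.exp (p * (r / n))) / w := by
    rw [Real.rpow_sub_one hwpos.ne', hw, Real.mul_rpow (by positivity) (Real.exp_pos _).le,
      Real.mul_rpow (by positivity) hv.le, ← Real.exp_mul, mul_comm p, mul_assoc]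
  have e3 : (n ^ 2 + θ * w) / √w = n * mixScale s B θ (r / n) := by
    rw [mixScale, hwn, Real.sqrt_mul (by positivity), Real.sqrt_sq hn.le]
    field_simp
  have e4 : Real.exp (-(1 / 2) * (a ^ 2 * w⁻¹ + b ^ 2 * w)) =
      Real.exp (-(a ^ 2 / 2) * w⁻¹) * Real.exp (-(b ^ 2 / 2 * w)) := by
    rw [← Real.exp_add]; congr 1; ring
  have e5 : (n ^ 2) ^ (-p) * (n ^ 2) ^ p = 1 := by
    rw [← Real.rpow_add (by positivity)]; simp
  rw [mixKernel, e3, e4, e2, ← hwn, sub_eq_add_neg, Real.exp_add, pow_succ]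
  calc _ = ((n ^ 2) ^ (-p) * (n ^ 2) ^ p) * ((s / B) ^ p * Real.exp (p * (r / n)) *
        Real.exp (-(a ^ 2 / 2) * w⁻¹) *
        (n ^ k * (Real.exp (s * (B + s * θ) * n ^ 2) * Real.exp (-(b ^ 2 / 2 * w))) *
          H (n * mixScale s B θ (r / n)))) := by field_simp
    _ = _ := by rw [e5, one_mul]

/-- Dominated convergence in r: the phase tends to sBr²/2, while the factors containing p and a tend
to constants. The domination combines `mixKernel_bound` with cosh x - 1 ≥ x²/2. -/
lemma gigMixture_tendsto (p a : ℝ) (hH : Measurable H) (h0 : ∀ t, 0 ≤ H t) (h1 : ∀ t, H t ≤ 1)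
    (hs : 0 < s) (hb : 0 < b) (hB : 0 < B) (hB2 : B ^ 2 = θ ^ 2 * s ^ 2 + b ^ 2)
    (hlim : Tendsto (fun t => t ^ k * Real.exp (s ^ 2 * t ^ 2 / 2) * H t) atTop (𝓝 c)) :
    Tendsto (fun y => √y ^ (k + 1) * y ^ (-p) * Real.exp (s * (B + s * θ) * y) *
        gigMixture p a b θ H y) atTop
      (𝓝 ((s / B) ^ p * (c / mixScale s B θ 0 ^ k) * √(Real.pi / (s * B / 2)))) := by
  have hv : 0 < s / B := by positivity
  suffices h : Tendsto (fun n : ℝ => ∫ r : ℝ, (s / B) ^ p * Real.exp (p * (r / n)) *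
      Real.exp (-(a ^ 2 / 2) * (n ^ 2 * (s / B) * Real.exp (r / n))⁻¹) *
        mixKernel k H s b θ B n (r / n)) atTop
      (𝓝 (∫ r : ℝ, (s / B) ^ p * (c / mixScale s B θ 0 ^ k) *
        Real.exp (-(s * B / 2) * r ^ 2))) by
    rw [integral_const_mul, integral_gaussian] at h
    refine (h.comp Real.tendsto_sqrt_atTop).congr' ?_
    filter_upwards [eventually_gt_atTop 0] with y hy
    rw [Function.comp_apply, ← gigMixture_sq_eq p a hs hB (Real.sqrt_pos.2 hy),
      Real.sq_sqrt hy.le]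
  obtain ⟨C, κ, hκ, hC, hbound⟩ := mixKernel_bound h0 h1 hs hb hB hB2 hlim
  refine tendsto_integral_filter_of_dominated_convergence
    (fun r => (s / B) ^ p * C * Real.exp (p ^ 2 / κ) * Real.exp (-(κ / 4) * r ^ 2)) ?_ ?_
    ((integrable_exp_neg_mul_sq (by positivity)).const_mul _) ?_
  · refine Eventually.of_forall fun n => Measurable.aestronglyMeasurable ?_
    unfold mixKernel mixScale
    fun_prop
  · filter_upwards [eventually_ge_atTop 1] with n hn
    refine Eventually.of_forall fun r => ?_
    have hn0 : 0 < n := by linarith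
    have hm0 : 0 ≤ mixKernel k H s b θ B n (r / n) :=
      mul_nonneg (by positivity) (h0 _)
    have hm1 := hbound n (r / n) hn
    rw [Real.norm_eq_abs, abs_of_nonneg (mul_nonneg (by positivity) hm0)]
    have ha : Real.exp (-(a ^ 2 / 2) * (n ^ 2 * (s / B) * Real.exp (r / n))⁻¹) ≤ 1 := by
      rw [Real.exp_le_one_iff, neg_mul, neg_nonpos]
      positivity
    have hg : r ^ 2 / 2 ≤ n ^ 2 * (Real.cosh (r / n) - 1) := by
      have := mul_le_mul_of_nonneg_left (half_sq_le_cosh_sub_one (r / n)) (sq_nonneg n)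
      refine le_trans (le_of_eq ?_) this
      field_simp
    -- Completing the square absorbs e^{pr/n} at the cost of e^{p²/κ} and half of the Gaussian rate
    -- κ/2.
    have hexp : Real.exp (p * (r / n)) * Real.exp (-κ * (n ^ 2 * (Real.cosh (r / n) - 1))) ≤
        Real.exp (p ^ 2 / κ) * Real.exp (-(κ / 4) * r ^ 2) := by
      rw [← Real.exp_add, ← Real.exp_add, Real.exp_le_exp]
      have e1 : p * (r / n) ≤ p ^ 2 / κ + κ / 4 * (r / n) ^ 2 := by
        have : 0 ≤ (p - κ / 2 * (r / n)) ^ 2 / κ := by positivity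
        have e : (p - κ / 2 * (r / n)) ^ 2 / κ =
          p ^ 2 / κ - p * (r / n) + κ / 4 * (r / n) ^ 2 := by field_simp; ring
        linarith
      have e2 : (r / n) ^ 2 ≤ r ^ 2 := by
        rw [div_pow]
        exact div_le_self (sq_nonneg r) (one_le_pow₀ hn)
      have e3 := mul_le_mul_of_nonneg_left hg hκ.le
      have e4 := mul_le_mul_of_nonneg_left e2 (by positivity : 0 ≤ κ / 4)
      linarith
    calc _ ≤ (s / B) ^ p * Real.exp (p * (r / n)) * 1 *
          (C * Real.exp (-κ * (n ^ 2 * (Real.cosh (r / n) - 1)))) := by gcongr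
      _ = (s / B) ^ p * C *
          (Real.exp (p * (r / n)) * Real.exp (-κ * (n ^ 2 * (Real.cosh (r / n) - 1)))) := by ring
      _ ≤ (s / B) ^ p * C * (Real.exp (p ^ 2 / κ) * Real.exp (-(κ / 4) * r ^ 2)) := by gcongr
      _ = _ := by ring
  · refine Eventually.of_forall fun r => ?_
    have hx : Tendsto (fun n : ℝ => r / n) atTop (𝓝 0) := tendsto_const_nhds.div_atTop tendsto_id
    have t1 : Tendsto (fun n : ℝ => Real.exp (p * (r / n))) atTop (𝓝 1) := by
      have := (Real.continuous_exp.tendsto _).comp (hx.const_mul p)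
      simpa [Function.comp_def] using this
    have t2 : Tendsto (fun n : ℝ =>
        Real.exp (-(a ^ 2 / 2) * (n ^ 2 * (s / B) * Real.exp (r / n))⁻¹)) atTop (𝓝 1) := by
      have hE : Tendsto (fun n : ℝ => Real.exp (r / n)) atTop (𝓝 1) := by
        have := (Real.continuous_exp.tendsto _).comp hx
        simpa [Function.comp_def] using this
      have hw : Tendsto (fun n : ℝ => n ^ 2 * (s / B) * Real.exp (r / n)) atTop atTop :=
        ((tendsto_pow_atTop two_ne_zero).atTop_mul_const hv).atTop_mul_pos one_pos hE
      have := (Real.continuous_exp.tendsto _).comp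
        ((tendsto_inv_atTop_zero.comp hw).const_mul (-(a ^ 2 / 2)))
      simpa [Function.comp_def] using this
    have t3 := mixKernel_tendsto (k := k) hs hb hB hB2 hlim r
    have := ((t1.const_mul ((s / B) ^ p)).mul t2).mul t3
    simpa only [mul_one, mul_assoc] using this

end Mixture

/-! ### Quantiles of laws on the line -/

section Quantile

variable {μ : Measure ℝ} {u v : ℝ}

lemma bddBelow_quantile_set (hu : 0 < u) : BddBelow {x : ℝ | u ≤ cdf μ x} := by
  obtain ⟨x, hx⟩ := ((tendsto_cdf_atBot μ).eventually (gt_mem_nhds hu)).exists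
  exact ⟨x, fun y hy => le_of_lt ((monotone_cdf μ).reflect_lt (hx.trans_le hy))⟩

lemma nonempty_quantile_set (hu : u < 1) : {x : ℝ | u ≤ cdf μ x}.Nonempty := by
  obtain ⟨x, hx⟩ := ((tendsto_cdf_atTop μ).eventually (lt_mem_nhds hu)).exists
  exact ⟨x, hx.le⟩

lemma quantile_le (hu : 0 < u) {x : ℝ} (hx : u ≤ cdf μ x) : quantile μ u ≤ x :=
  csInf_le (bddBelow_quantile_set hu) hx

lemma quantile_mono (hu : 0 < u) (huv : u ≤ v) (hv : v < 1) : quantile μ u ≤ quantile μ v :=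
  csInf_le_csInf (bddBelow_quantile_set hu) (nonempty_quantile_set hv)
    fun _ hx => huv.trans hx

lemma le_cdf_quantile (hu1 : u < 1) : u ≤ cdf μ (quantile μ u) := by
  refine ge_of_tendsto
    (((cdf μ).right_continuous (quantile μ u)).tendsto.mono_left
      (nhdsWithin_mono _ Set.Ioi_subset_Ici_self)) ?_
  filter_upwards [self_mem_nhdsWithin] with x hx
  obtain ⟨y, hy, hyx⟩ := exists_lt_of_csInf_lt (nonempty_quantile_set (μ := μ) hu1) hx
  exact le_trans hy (monotone_cdf μ hyx.le)

/-- Without atoms the value of the distribution function is its left limit, and to the left of the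
quantile it stays below u. -/
lemma cdf_quantile [IsProbabilityMeasure μ] [NullSingletonClass μ] (hu0 : 0 < u) (hu1 : u < 1) : cdf μ (quantile μ u) = u := by
  refine le_antisymm ?_ (le_cdf_quantile hu1)
  have h := (cdf μ).measure_singleton (quantile μ u)
  rw [measure_cdf, measure_singleton, eq_comm, ENNReal.ofReal_eq_zero, sub_nonpos] at h
  refine h.trans (le_of_tendsto ((monotone_cdf μ).tendsto_leftLim _) ?_)
  filter_upwards [self_mem_nhdsWithin] with x hx
  by_contra hlt
  exact absurd (quantile_le hu0 (not_le.1 hlt).le) (not_le.2 hx)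

lemma quantile_tendsto_atBot (hpos : ∀ x, 0 < cdf μ x) :
    Tendsto (quantile μ) (𝓝[>] 0) atBot := by
  refine tendsto_atBot.2 fun x => ?_
  filter_upwards [Ioo_mem_nhdsGT (hpos x)] with u hu using quantile_le hu.1 hu.2.le

end Quantile

/-! ### Tail probabilities as mixtures -/

section Mixing

variable {ρ θ p a b : ℝ}

lemma measurable_gigPDF (p a b : ℝ) : Measurable (gigPDF p a b) := by
  unfold gigPDF
  exact Measurable.ite measurableSet_Ioi (by fun_prop) measurable_const

lemma measurable_skewGH_map (θ : EuclideanSpace ℝ (Fin 2)) :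
    Measurable fun q : ℝ × EuclideanSpace ℝ (Fin 2) => q.1 • θ + √q.1 • q.2 := by
  fun_prop

instance sFinite_gigMeasure (p a b : ℝ) : SFinite (gigMeasure p a b) := by
  unfold gigMeasure; infer_instance

lemma skewGH_apply (θ : EuclideanSpace ℝ (Fin 2)) {S : Set (EuclideanSpace ℝ (Fin 2))}
    (hS : MeasurableSet S) :
    skewGH ρ θ p a b S = ∫⁻ w in Set.Ioi 0, ENNReal.ofReal (gigPDF p a b w) *
      multivariateGaussian 0 (corrMatrix ρ) {z | w • θ + √w • z ∈ S} := by
  rw [skewGH, Measure.map_apply (measurable_skewGH_map θ) hS,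
    Measure.prod_apply (measurable_skewGH_map θ hS), gigMeasure,
    lintegral_withDensity_eq_lintegral_mul _ (measurable_gigPDF p a b).ennreal_ofReal
      (measurable_measure_prodMk_left (measurable_skewGH_map θ hS)),
    ← lintegral_indicator measurableSet_Ioi]
  refine lintegral_congr fun w => ?_
  by_cases hw : 0 < w
  · rw [Set.indicator_of_mem (Set.mem_Ioi.2 hw)]
    rfl
  · rw [Set.indicator_of_notMem (by simpa using hw)]
    simp [gigPDF, hw]

/-- Were the constant nonpositive (1/0 = 0 included), the density would be nonpositive,
`ENNReal.ofReal` would truncate it to 0 and the total mass would vanish. No Bessel or Gamma value is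
needed. -/
lemma barK_pos_of_isProbabilityMeasure {θ : EuclideanSpace ℝ (Fin 2)}
    (h : IsProbabilityMeasure (skewGH ρ θ p a b)) : 0 < barK p a b := by
  by_contra hK
  have hz : skewGH ρ θ p a b Set.univ = 0 := by
    rw [skewGH_apply θ MeasurableSet.univ, setLIntegral_congr_fun (g := 0) measurableSet_Ioi,
      Pi.zero_def, lintegral_zero]
    intro w hw
    have hw : 0 < w := hw
    have : gigPDF p a b w ≤ 0 := by
      rw [gigPDF, if_pos hw]
      refine mul_nonpos_of_nonpos_of_nonneg (mul_nonpos_of_nonpos_of_nonneg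
        (one_div_nonpos.2 (by linarith)) (by positivity)) (by positivity)
    simp [ENNReal.ofReal_of_nonpos this]
  rw [measure_univ] at hz
  exact one_ne_zero hz

/-- The mass of `S` under the mixture, when the conditional mass of `S` given `W = w` is
`H((y + θ w) / √w)`. -/
lemma skewGH_real_eq_gigMixture (hK : 0 < barK p a b) {S : Set (EuclideanSpace ℝ (Fin 2))}
    (hS : MeasurableSet S) {H : ℝ → ℝ} (hH : Measurable H) (h0 : ∀ t, 0 ≤ H t) {y : ℝ}
    (hSH : ∀ w, 0 < w → (multivariateGaussian 0 (corrMatrix ρ)).real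
      {z | w • (!₂[θ, θ] : EuclideanSpace ℝ (Fin 2)) + √w • z ∈ S} = H ((y + θ * w) / √w)) :
    (skewGH ρ !₂[θ, θ] p a b).real S = 1 / (2 * barK p a b) * gigMixture p a b θ H y := by
  have hm : Measurable fun w => 1 / (2 * barK p a b) *
      (w ^ (p - 1) * Real.exp (-(1 / 2) * (a ^ 2 * w⁻¹ + b ^ 2 * w)) *
        H ((y + θ * w) / √w)) := by fun_prop
  rw [gigMixture, ← integral_const_mul, integral_eq_lintegral_of_nonneg_ae _
    hm.aestronglyMeasurable, measureReal_def, skewGH_apply _ hS]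
  · congr 1
    refine setLIntegral_congr_fun measurableSet_Ioi fun w hw => ?_
    have hw : 0 < w := hw
    rw [← ofReal_measureReal, hSH w hw, ← ENNReal.ofReal_mul, gigPDF, if_pos hw]
    · congr 1
      ring
    · rw [gigPDF, if_pos hw]
      positivity
  · refine (ae_restrict_iff' measurableSet_Ioi).2 (Eventually.of_forall fun w hw => ?_)
    have hw : 0 < w := hw
    have := h0 ((y + θ * w) / √w)
    show 0 ≤ _
    positivity

lemma orthantTail_nonneg (ρ t : ℝ) : 0 ≤ orthantTail ρ t := measureReal_nonneg

lemma orthantTail_le_one (ρ t : ℝ) : orthantTail ρ t ≤ 1 := measureReal_le_one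

lemma orthantTail_antitone (ρ : ℝ) : Antitone (orthantTail ρ) := fun _ _ h =>
  measureReal_mono fun _ hz => ⟨hz.1.trans (neg_le_neg h), hz.2.trans (neg_le_neg h)⟩

lemma add_sqrt_mul_le_iff {w : ℝ} (hw : 0 < w) (y z : ℝ) :
    w * θ + √w * z ≤ -y ↔ z ≤ -((y + θ * w) / √w) := by
  have hsw : 0 < √w := Real.sqrt_pos.2 hw
  rw [← neg_div, le_div_iff₀ hsw]
  constructor <;> intro h <;> linarith

lemma multivariateGaussian_corrMatrix_map_eval (h1 : -1 < ρ) (h2 : ρ < 1) (i : Fin 2) :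
    MeasurePreserving (fun z : EuclideanSpace ℝ (Fin 2) => z i)
      (multivariateGaussian 0 (corrMatrix ρ)) (gaussianReal 0 1) := by
  have h := measurePreserving_eval_multivariateGaussian (μ := 0) (corrMatrix_posSemidef h1 h2)
    (i := i)
  have e : corrMatrix ρ i i = 1 := by fin_cases i <;> simp [corrMatrix]
  simpa [e] using h

lemma skewGH_real_orthant (hK : 0 < barK p a b) (y : ℝ) :
    (skewGH ρ !₂[θ, θ] p a b).real {x | x 0 ≤ -y ∧ x 1 ≤ -y} =
      1 / (2 * barK p a b) * gigMixture p a b θ (orthantTail ρ) y := by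
  refine skewGH_real_eq_gigMixture hK (measurableSet_setOfPred.2 (by fun_prop))
    (orthantTail_antitone ρ).measurable (orthantTail_nonneg ρ) fun w hw => ?_
  rw [orthantTail]
  congr 1
  ext z
  simp [add_sqrt_mul_le_iff hw]

lemma skewGH_real_margin (h1 : -1 < ρ) (h2 : ρ < 1) (hK : 0 < barK p a b) (i : Fin 2) (y : ℝ) :
    (skewGH ρ !₂[θ, θ] p a b).real {x | x i ≤ -y} =
      1 / (2 * barK p a b) * gigMixture p a b θ gaussTail y := by
  refine skewGH_real_eq_gigMixture hK (measurableSet_setOfPred.2 (by fun_prop))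
    gaussTail_measurable gaussTail_nonneg fun w hw => ?_
  rw [gaussTail, ← (multivariateGaussian_corrMatrix_map_eval h1 h2 i).measureReal_preimage
    measurableSet_Iic.nullMeasurableSet]
  congr 1
  ext z
  have := add_sqrt_mul_le_iff (θ := θ) hw y (z i)
  fin_cases i <;> simpa using this

lemma skewGH_margin_singleton (h1 : -1 < ρ) (h2 : ρ < 1) (i : Fin 2) (x : ℝ) :
    skewGH ρ !₂[θ, θ] p a b {z | z i = x} = 0 := by
  rw [skewGH_apply _ (measurableSet_setOfPred.2 (by fun_prop)),
    setLIntegral_congr_fun (g := 0) measurableSet_Ioi, Pi.zero_def, lintegral_zero]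
  intro w hw
  have hsw : 0 < √w := Real.sqrt_pos.2 hw
  have e : {z : EuclideanSpace ℝ (Fin 2) | w • (!₂[θ, θ] : EuclideanSpace ℝ (Fin 2)) + √w • z ∈
      {z : EuclideanSpace ℝ (Fin 2) | z i = x}} =
      (fun z : EuclideanSpace ℝ (Fin 2) => z i) ⁻¹' {(x - w * θ) / √w} := by
    ext z
    have : w * θ + √w * z i = x ↔ z i = (x - w * θ) / √w := by
      rw [eq_div_iff hsw.ne']
      constructor <;> intro h <;> linarith
    fin_cases i <;> simpa using this
  have hna : NullSingletonClass (gaussianReal 0 1) := nullSingletonClass_gaussianReal one_ne_zero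
  simp only
  rw [e, (multivariateGaussian_corrMatrix_map_eval h1 h2 i).measure_preimage
    (measurableSet_singleton _).nullMeasurableSet, measure_singleton, mul_zero]
  rfl

end Mixing

/-! ### Slow variation and elimination of the threshold -/

lemma tendsto_mul_nhdsGT_zero {l : ℝ} (hl : 0 < l) :
    Tendsto (fun u => l * u) (𝓝[>] 0) (𝓝[>] 0) := by
  refine tendsto_nhdsWithin_of_tendsto_nhds_of_eventually_within _ ?_ ?_
  · have : Tendsto (fun u : ℝ => l * u) (𝓝 0) (𝓝 (l * 0)) := (continuous_const_mul l).tendsto 0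
    rw [mul_zero] at this
    exact this.mono_left nhdsWithin_le_nhds
  · filter_upwards [self_mem_nhdsWithin] with u hu using mul_pos hl hu

lemma abs_log_mul_div_abs_log_tendsto {l : ℝ} (hl : 0 < l) :
    Tendsto (fun u => |Real.log (l * u)| / |Real.log u|) (𝓝[>] 0) (𝓝 1) := by
  have h : Tendsto (fun u => |Real.log l / Real.log u + 1|) (𝓝[>] 0) (𝓝 |0 + 1|) :=
    ((Tendsto.div_atBot tendsto_const_nhds Real.tendsto_log_nhdsGT_zero).add_const 1).abs
  rw [zero_add, abs_one] at h
  refine h.congr' ?_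
  filter_upwards [self_mem_nhdsWithin, Real.tendsto_log_nhdsGT_zero.eventually_lt_atBot 0]
    with u hu hlog
  have hu : 0 < u := hu
  rw [Real.log_mul hl.ne' hu.ne', ← abs_div, add_div, div_self hlog.ne]

/-- Everything reduces to log(lu)/log u → 1; the positive limit C forces L > 0 near 0. -/
lemma slowlyVaryingAtZero_of_tendsto {L : ℝ → ℝ} {C κ : ℝ} (hC : 0 < C)
    (hm : Measurable ((Set.Ioo 0 1).domRestrict L))
    (hL : Tendsto (fun u => L u / |Real.log u| ^ κ) (𝓝[>] 0) (𝓝 C)) :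
    SlowlyVaryingAtZero L := by
  have hlog : ∀ᶠ u : ℝ in 𝓝[>] 0, 0 < |Real.log u| := by
    filter_upwards [Real.tendsto_log_nhdsGT_zero.eventually_lt_atBot 0] with u hu
    exact abs_pos.2 hu.ne
  refine ⟨?_, fun l hl => ?_⟩
  · have hpos : ∀ᶠ u in 𝓝[>] 0, 0 < L u := by
      filter_upwards [hlog, hL.eventually (lt_mem_nhds hC)] with u h1 h2
      have h3 : 0 < |Real.log u| ^ κ := by positivity
      exact (div_pos_iff_of_pos_right h3).1 h2
    obtain ⟨c, hc, hsub⟩ := mem_nhdsGT_iff_exists_Ioo_subset.1 hpos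
    have hc : 0 < c := hc
    refine ⟨min c 1, lt_min hc one_pos, fun u hu =>
      hsub ⟨hu.1, hu.2.trans_le (min_le_left _ _)⟩, ?_⟩
    have hsub' : Set.Ioo (0 : ℝ) (min c 1) ⊆ Set.Ioo 0 1 :=
      Set.Ioo_subset_Ioo_right (min_le_right _ _)
    exact hm.comp (measurable_inclusion hsub')
  · have h1 := hL.comp (tendsto_mul_nhdsGT_zero hl)
    have h2 := (abs_log_mul_div_abs_log_tendsto hl).rpow_const (p := κ) (Or.inl one_ne_zero)
    have h3 := (h1.mul h2).div hL hC.ne'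
    rw [Real.one_rpow, mul_one, div_self hC.ne'] at h3
    refine h3.congr' ?_
    filter_upwards [hlog, (tendsto_mul_nhdsGT_zero hl).eventually hlog] with u hu hlu
    simp only [Function.comp_apply, Pi.div_apply]
    rw [Real.div_rpow hlu.le hu.le]
    have e1 : 0 < |Real.log u| ^ κ := by positivity
    have e2 : 0 < |Real.log (l * u)| ^ κ := by positivity
    field_simp

/-- Passing from the tails `F(y)` and `J(y)` to the asymptotics of `J(y(u)) / u ^ τ`, where `y(u)`
solves `F(y) = u`. -/
lemma tendsto_div_rpow_of_tails {F J y : ℝ → ℝ} {A D δ τ p : ℝ} (hA : 0 < A) (hδ : 0 < δ)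
    (hF : Tendsto (fun x => x ^ (1 - p) * Real.exp (δ * x) * F x) atTop (𝓝 A))
    (hJ : Tendsto (fun x => x ^ (3 / 2 - p) * Real.exp (δ * τ * x) * J x) atTop (𝓝 D))
    (hy : Tendsto y (𝓝[>] 0) atTop) (hFy : ∀ᶠ u in 𝓝[>] 0, F (y u) = u) :
    Tendsto (fun u => J (y u) / u ^ τ / |Real.log u| ^ ((p - 1) * (1 - τ) - 1 / 2)) (𝓝[>] 0)
      (𝓝 (D * A ^ (-τ) * δ ^ (-((p - 1) * (1 - τ) - 1 / 2)))) := by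
  set κ := (p - 1) * (1 - τ) - 1 / 2 with hκ
  set f := fun u => y u ^ (1 - p) * Real.exp (δ * y u) * u with hf
  have hfl : Tendsto f (𝓝[>] 0) (𝓝 A) := by
    refine (hF.comp hy).congr' ?_
    filter_upwards [hFy] with u hu
    rw [Function.comp_apply, hu]
  have hjl := hJ.comp hy
  have hlogu : ∀ᶠ u in 𝓝[>] 0, 0 < y u ∧ 0 < u ∧ 0 < f u ∧
      Real.log u = Real.log (f u) + (p - 1) * Real.log (y u) - δ * y u := by
    filter_upwards [hy.eventually_gt_atTop 0, self_mem_nhdsWithin] with u hyu hu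
    have hu : 0 < u := hu
    refine ⟨hyu, hu, by simp only [hf]; positivity, ?_⟩
    have h1 : y u ^ (1 - p) ≠ 0 := (Real.rpow_pos_of_pos hyu _).ne'
    simp only [hf]
    rw [Real.log_mul (mul_ne_zero h1 (Real.exp_pos _).ne') hu.ne',
      Real.log_mul h1 (Real.exp_pos _).ne', Real.log_exp, Real.log_rpow hyu]
    ring
  -- Taking logarithms in f(u) → A, the terms log f(u) and log y are negligible against y.
  have hratio : Tendsto (fun u => |Real.log u| / y u) (𝓝[>] 0) (𝓝 δ) := by
    have h1 : Tendsto (fun u => Real.log (f u) / y u) (𝓝[>] 0) (𝓝 0) :=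
      (hfl.log hA.ne').div_atTop hy
    have h2 : Tendsto (fun u => Real.log (y u) / y u) (𝓝[>] 0) (𝓝 0) :=
      Real.isLittleO_log_id_atTop.tendsto_div_nhds_zero.comp hy
    have h3 := ((h1.add (h2.const_mul (p - 1))).sub_const δ).abs
    rw [show |(0 : ℝ) + (p - 1) * 0 - δ| = δ by simp [abs_of_pos hδ]] at h3
    refine h3.congr' ?_
    filter_upwards [hlogu] with u ⟨hyu, hu, hfu, hl⟩
    rw [hl, ← abs_of_pos hyu, ← abs_div, abs_of_pos hyu]
    congr 1
    field_simp
  have h1 := (hjl.mul (hfl.rpow_const (p := -τ) (Or.inl hA.ne'))).mul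
    (hratio.rpow_const (p := -κ) (Or.inl hδ.ne'))
  refine h1.congr' ?_
  filter_upwards [hlogu, Real.tendsto_log_nhdsGT_zero.eventually_lt_atBot 0]
    with u ⟨hyu, hu, hfu, _⟩ hneg
  have habs : 0 < |Real.log u| := abs_pos.2 hneg.ne
  simp only [Function.comp_apply, hf]
  rw [Real.div_rpow habs.le hyu.le, Real.mul_rpow (by positivity) hu.le,
    Real.mul_rpow (by positivity) (Real.exp_pos _).le, ← Real.exp_mul, ← Real.rpow_mul hyu.le,
    Real.rpow_neg hu.le, Real.rpow_neg habs.le, Real.rpow_neg hyu.le κ]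
  have e1 : Real.exp (δ * τ * y u) * Real.exp (δ * y u * -τ) = 1 := by
    rw [← Real.exp_add]
    simp
    ring
  -- The value of κ is exactly what makes the powers of y cancel.
  have e2 : y u ^ (3 / 2 - p) * y u ^ ((1 - p) * -τ) * y u ^ κ = 1 := by
    rw [← Real.rpow_add hyu, ← Real.rpow_add hyu, hκ]
    ring_nf
    simp
  have h3 : 0 < y u ^ κ := by positivity
  calc _ = (Real.exp (δ * τ * y u) * Real.exp (δ * y u * -τ)) *
        (y u ^ (3 / 2 - p) * y u ^ ((1 - p) * -τ) * y u ^ κ) *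
          (J (y u) / u ^ τ / |Real.log u| ^ κ) := by field_simp
    _ = _ := by rw [e1, e2, one_mul, one_mul]

/-! ### Constants and tails of the equi-skew law -/

namespace EquiSkewGH

variable {ρ θ p a b : ℝ}

lemma delta_pos (hb : 0 < b) : 0 < delta θ b := by
  have h : |θ| < √(θ ^ 2 + b ^ 2) := by
    rw [← Real.sqrt_sq_eq_abs]
    exact Real.sqrt_lt_sqrt (sq_nonneg θ) (by have := pow_pos hb 2; linarith)
  have := (abs_lt.1 h).1
  rw [delta]
  linarith

lemma beta_pos (hb : 0 < b) : 0 < beta ρ θ b :=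
  Real.sqrt_pos.2 (by positivity)

lemma beta_sq : beta ρ θ b ^ 2 = θ ^ 2 * √(1 + alpha ρ ^ 2) ^ 2 + b ^ 2 := by
  rw [beta, Real.sq_sqrt (by positivity), Real.sq_sqrt (by positivity)]

lemma gamma_pos (hb : 0 < b) : 0 < gamma ρ θ b :=
  abs_lt_of_sq_eq hb (beta_pos hb) beta_sq

/-- Put s = √(1+α²) > 1 and B = √(θ²+b²). The claim is sγ > δ. Multiplied by sβ + B > 0, the
difference sγ - δ becomes (s²-1)(γ²+δ²)/2, which is positive whatever the sign of θ. -/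
lemma one_lt_tau (h1 : -1 < ρ) (h2 : ρ < 1) (hb : 0 < b) : 1 < tau ρ θ b := by
  have hα : 0 < alpha ρ ^ 2 := pow_pos (alpha_pos h1 h2) 2
  have hs2 : √(1 + alpha ρ ^ 2) ^ 2 = 1 + alpha ρ ^ 2 := Real.sq_sqrt (by positivity)
  have hs : 1 < √(1 + alpha ρ ^ 2) := by
    rw [Real.lt_sqrt one_pos.le]; linarith
  have hβ := beta_pos (ρ := ρ) (θ := θ) hb
  have hβ2 : beta ρ θ b ^ 2 = _ := beta_sq
  have hγ := gamma_pos (ρ := ρ) (θ := θ) hb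
  have hδ := delta_pos (θ := θ) hb
  rw [tau, one_lt_div hδ]
  rw [gamma] at *
  rw [delta] at *
  have hB : √(θ ^ 2 + b ^ 2) ^ 2 = θ ^ 2 + b ^ 2 := Real.sq_sqrt (by positivity)
  have hB0 : 0 < √(θ ^ 2 + b ^ 2) := Real.sqrt_pos.2 (by positivity)
  generalize √(1 + alpha ρ ^ 2) = s at *
  generalize beta ρ θ b = β at *
  generalize √(θ ^ 2 + b ^ 2) = B at *
  have hs0 : 0 < s := by linarith
  have h3 : 0 < θ ^ 2 * (s ^ 2 + 1) + b ^ 2 + θ * (s * β + B) := by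
    have e1 := pow_pos hγ 2
    have e2 := pow_pos hδ 2
    linear_combination (e1 + e2 + hβ2 + hB) / 2
  have h4 : 0 < (s * β + B) * (s * (β + s * θ) - (B + θ)) := by
    have e1 : 0 < s ^ 2 - 1 := by nlinarith
    refine lt_of_lt_of_eq (mul_pos e1 h3) ?_
    linear_combination -s ^ 2 * hβ2 + hB
  have h5 := pos_of_mul_pos_right h4 (by positivity)
  linarith

end EquiSkewGH

namespace EquiSkewGH

variable {ρ θ p a b : ℝ}

lemma constA_pos (hb : 0 < b) (hK : 0 < barK p a b) : 0 < constA θ p a b := by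
  have := delta_pos (θ := θ) hb
  rw [constA]
  positivity

/-- The Laplace asymptotics with s = 1, k = 1, B = √(θ²+b²): the rate is B + θ = δ. -/
lemma margin_tendsto (hb : 0 < b) (hK : 0 < barK p a b) :
    Tendsto (fun y => y ^ (1 - p) * Real.exp (delta θ b * y) *
      (1 / (2 * barK p a b) * gigMixture p a b θ gaussTail y)) atTop (𝓝 (constA θ p a b)) := by
  have hB : 0 < √(θ ^ 2 + b ^ 2) := Real.sqrt_pos.2 (by positivity)
  have hδ := delta_pos (θ := θ) hb
  have hB2 : √(θ ^ 2 + b ^ 2) ^ 2 = θ ^ 2 * (1 : ℝ) ^ 2 + b ^ 2 := by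
    rw [Real.sq_sqrt (by positivity)]; ring
  have hlim : Tendsto (fun t => t ^ 1 * Real.exp ((1 : ℝ) ^ 2 * t ^ 2 / 2) * gaussTail t) atTop
      (𝓝 (√(2 * Real.pi))⁻¹) := by
    simpa using gaussTail_mul_tendsto
  have h := (gigMixture_tendsto p a gaussTail_measurable gaussTail_nonneg gaussTail_le_one
    one_pos hb hB hB2 hlim).const_mul (1 / (2 * barK p a b))
  have hpow : (θ ^ 2 + b ^ 2) ^ (p / 2) = √(θ ^ 2 + b ^ 2) ^ p := by
    rw [Real.sqrt_eq_rpow, ← Real.rpow_mul (by positivity)]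
    congr 1
    ring
  have hc : 1 / (2 * barK p a b) * ((1 / √(θ ^ 2 + b ^ 2)) ^ p *
      ((√(2 * Real.pi))⁻¹ / mixScale 1 √(θ ^ 2 + b ^ 2) θ 0 ^ 1) *
        √(Real.pi / (1 * √(θ ^ 2 + b ^ 2) / 2))) = constA θ p a b := by
    rw [constA, hpow, mixScale, delta]
    rw [delta] at hδ
    generalize √(θ ^ 2 + b ^ 2) = B at *
    have e1 : √(Real.pi / (1 * B / 2)) = √(2 * Real.pi) / √B := by
      rw [← Real.sqrt_div (by positivity)]
      congr 1
      field_simp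
    have e2 : √(1 / B * Real.exp 0) = 1 / √B := by simp
    have e3 : √B ^ 2 = B := Real.sq_sqrt hB.le
    have e4 : 1 + θ * (1 / B * Real.exp 0) = (B + θ) / B := by
      rw [Real.exp_zero]; field_simp
    have hsB : 0 < √B := Real.sqrt_pos.2 hB
    rw [e1, e2, e4, Real.div_rpow one_pos.le hB.le, Real.one_rpow, pow_one]
    field_simp
    rw [e3]
  rw [hc] at h
  refine h.congr' ?_
  filter_upwards [eventually_gt_atTop 0] with y hy
  rw [sub_eq_add_neg, Real.rpow_add hy, Real.rpow_one, one_add_one_eq_two, Real.sq_sqrt hy.le,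
    one_mul, one_mul, delta]
  ring

/-- The Laplace asymptotics with s = √(1+α²), k = 2, B = β: the rate is sγ = δτ. The power of δ in
the limit only undoes the one inside `const1`. -/
lemma joint_tendsto (h1 : -1 < ρ) (h2 : ρ < 1) (hb : 0 < b) (hK : 0 < barK p a b) :
    Tendsto (fun y => y ^ (3 / 2 - p) * Real.exp (delta θ b * tau ρ θ b * y) *
      (1 / (2 * barK p a b) * gigMixture p a b θ (orthantTail ρ) y)) atTop
      (𝓝 (const1 ρ θ p a b * delta θ b ^ (p - 3 / 2))) := by
  have hα := alpha_pos h1 h2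
  have hs : 0 < √(1 + alpha ρ ^ 2) := Real.sqrt_pos.2 (by positivity)
  have hs2 : √(1 + alpha ρ ^ 2) ^ 2 = 1 + alpha ρ ^ 2 := Real.sq_sqrt (by positivity)
  have hB := beta_pos (ρ := ρ) (θ := θ) hb
  have hγ := gamma_pos (ρ := ρ) (θ := θ) hb
  have hδ := delta_pos (θ := θ) hb
  have hlim : Tendsto (fun t => t ^ 2 * Real.exp (√(1 + alpha ρ ^ 2) ^ 2 * t ^ 2 / 2) *
      orthantTail ρ t) atTop (𝓝 (1 / (Real.pi * alpha ρ * (1 + alpha ρ ^ 2)))) := by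
    rw [hs2]
    exact orthantTail_mul_tendsto h1 h2
  have h := (gigMixture_tendsto p a (orthantTail_antitone ρ).measurable (orthantTail_nonneg ρ)
    (orthantTail_le_one ρ) hs hb hB beta_sq hlim).const_mul (1 / (2 * barK p a b))
  have hpow : (1 + alpha ρ ^ 2) ^ ((p - 3 / 2) / 2) = √(1 + alpha ρ ^ 2) ^ (p - 3 / 2) := by
    rw [Real.sqrt_eq_rpow, ← Real.rpow_mul (by positivity)]
    congr 1
    ring
  have hc : 1 / (2 * barK p a b) * ((√(1 + alpha ρ ^ 2) / beta ρ θ b) ^ p *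
      (1 / (Real.pi * alpha ρ * (1 + alpha ρ ^ 2)) /
        mixScale √(1 + alpha ρ ^ 2) (beta ρ θ b) θ 0 ^ 2) *
        √(Real.pi / (√(1 + alpha ρ ^ 2) * beta ρ θ b / 2))) =
      const1 ρ θ p a b * delta θ b ^ (p - 3 / 2) := by
    rw [const1, hpow, mixScale]
    have hγ' : beta ρ θ b + √(1 + alpha ρ ^ 2) * θ = gamma ρ θ b := rfl
    generalize gamma ρ θ b = γ at *
    generalize beta ρ θ b = B at *
    generalize √(1 + alpha ρ ^ 2) = s at *
    rw [← hs2]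
    have e1 : √(Real.pi / (s * B / 2)) = √(2 * Real.pi) / (√s * √B) := by
      rw [← Real.sqrt_mul hs.le, ← Real.sqrt_div (by positivity)]
      congr 1
      field_simp
    have e2 : √(s / B * Real.exp 0) ^ 2 = s / B := by
      rw [Real.exp_zero, mul_one, Real.sq_sqrt (by positivity)]
    have e4 : 1 + θ * (s / B * Real.exp 0) = γ / B := by
      rw [Real.exp_zero, ← hγ']; field_simp
    have e5 : s ^ (p - 3 / 2) = s ^ p / (s * √s) := by
      rw [Real.rpow_sub hs, show (3 / 2 : ℝ) = 1 + 1 / 2 by norm_num, Real.rpow_add hs,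
        Real.rpow_one, ← Real.sqrt_eq_rpow]
    have e6 : B ^ (p - 1 / 2) = B ^ p / √B := by
      rw [Real.rpow_sub hB, ← Real.sqrt_eq_rpow]
    have e7 : √B ^ 2 = B := Real.sq_sqrt hB.le
    have e8 : √(2 * Real.pi) ^ 2 = 2 * Real.pi := Real.sq_sqrt (by positivity)
    rw [div_pow, e1, e2, e4, e5, e6, Real.div_rpow hs.le hB.le]
    have hsB : 0 < √B := Real.sqrt_pos.2 hB
    have hss : 0 < √s := Real.sqrt_pos.2 hs
    have hpi := Real.pi_pos
    field_simp
    rw [e7, e8]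
    ring
  rw [hc] at h
  refine h.congr' ?_
  filter_upwards [eventually_gt_atTop 0] with y hy
  have e1 : √y ^ (2 + 1) = y ^ (3 / 2 : ℝ) := by
    rw [Real.sqrt_eq_rpow, ← Real.rpow_natCast, ← Real.rpow_mul hy.le]
    norm_num
  have e2 : √(1 + alpha ρ ^ 2) * (beta ρ θ b + √(1 + alpha ρ ^ 2) * θ) =
      delta θ b * tau ρ θ b := by
    rw [tau, gamma]
    field_simp
  rw [sub_eq_add_neg, Real.rpow_add hy, e1, e2]
  ring

end EquiSkewGH

/-! ### Margins and copula diagonal of X -/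

lemma isProbabilityMeasure_skewGH_of_hasLaw {Ω : Type*} [MeasurableSpace Ω] {P : Measure Ω}
    [IsProbabilityMeasure P] {ρ p a b : ℝ} {θ : EuclideanSpace ℝ (Fin 2)}
    {X : Ω → EuclideanSpace ℝ (Fin 2)} (hX : HasLaw X (skewGH ρ θ p a b) P) :
    IsProbabilityMeasure (skewGH ρ θ p a b) :=
  hX.isProbabilityMeasure_iff.1 inferInstance

section Margins

variable {Ω : Type*} [MeasurableSpace Ω] {P : Measure Ω} {ρ θ p a b : ℝ}
  {X : Ω → EuclideanSpace ℝ (Fin 2)}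

lemma hasLaw_margin_apply (hX : HasLaw X (skewGH ρ !₂[θ, θ] p a b) P) (i : Fin 2) {S : Set ℝ}
    (hS : MeasurableSet S) :
    P.map (fun ω => X ω i) S = skewGH ρ !₂[θ, θ] p a b {x | x i ∈ S} := by
  have hm : Measurable fun x : EuclideanSpace ℝ (Fin 2) => x i := by fun_prop
  have e : {x : EuclideanSpace ℝ (Fin 2) | x i ∈ S} = (fun x => x i) ⁻¹' S := rfl
  rw [← hX.map_eq, e, Measure.map_apply_of_aemeasurable (f := fun ω => X ω i)
    (hm.comp_aemeasurable hX.aemeasurable) hS,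
    Measure.map_apply_of_aemeasurable hX.aemeasurable (hm hS)]
  rfl

lemma hasLaw_margin_nullSingletonClass (h1 : -1 < ρ) (h2 : ρ < 1)
    (hX : HasLaw X (skewGH ρ !₂[θ, θ] p a b) P) (i : Fin 2) :
    NullSingletonClass (P.map fun ω => X ω i) :=
  ⟨fun x => (hasLaw_margin_apply hX i (measurableSet_singleton x)).trans
    (skewGH_margin_singleton h1 h2 i x)⟩

variable [IsProbabilityMeasure P]

lemma hasLaw_margin_isProbabilityMeasure (hX : HasLaw X (skewGH ρ !₂[θ, θ] p a b) P) (i : Fin 2) :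
    IsProbabilityMeasure (P.map fun ω => X ω i) :=
  Measure.isProbabilityMeasure_map
    ((by fun_prop : Measurable fun x : EuclideanSpace ℝ (Fin 2) => x i).comp_aemeasurable
      hX.aemeasurable)

lemma hasLaw_margin_cdf (h1 : -1 < ρ) (h2 : ρ < 1) (hX : HasLaw X (skewGH ρ !₂[θ, θ] p a b) P)
    (i : Fin 2) (y : ℝ) :
    cdf (P.map fun ω => X ω i) (-y) =
      1 / (2 * barK p a b) * gigMixture p a b θ gaussTail y := by
  have := hasLaw_margin_isProbabilityMeasure hX i
  have hK := barK_pos_of_isProbabilityMeasure (isProbabilityMeasure_skewGH_of_hasLaw hX)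
  rw [cdf_eq_real, measureReal_def, hasLaw_margin_apply hX i measurableSet_Iic,
    ← skewGH_real_margin h1 h2 hK i]
  rfl

lemma hasLaw_margin_eq (h1 : -1 < ρ) (h2 : ρ < 1) (hX : HasLaw X (skewGH ρ !₂[θ, θ] p a b) P) :
    (P.map fun ω => X ω 1) = P.map fun ω => X ω 0 := by
  have := hasLaw_margin_isProbabilityMeasure hX 0
  have := hasLaw_margin_isProbabilityMeasure hX 1
  refine Measure.eq_of_cdf _ _ (StieltjesFunction.ext fun x => ?_)
  rw [← neg_neg x, hasLaw_margin_cdf h1 h2 hX, hasLaw_margin_cdf h1 h2 hX]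

lemma hasLaw_margin_cdf_pos (h1 : -1 < ρ) (h2 : ρ < 1) (hb : 0 < b)
    (hX : HasLaw X (skewGH ρ !₂[θ, θ] p a b) P) (i : Fin 2) (x : ℝ) :
    0 < cdf (P.map fun ω => X ω i) x := by
  have hK := barK_pos_of_isProbabilityMeasure (isProbabilityMeasure_skewGH_of_hasLaw hX)
  -- Far enough to the left the normalised tail is near A > 0; monotonicity carries positivity back
  -- to x.
  obtain ⟨y, hy, hy0, hyx⟩ := (((EquiSkewGH.margin_tendsto (θ := θ) hb hK).eventually
    (lt_mem_nhds (EquiSkewGH.constA_pos hb hK))).and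
      ((eventually_gt_atTop 0).and (eventually_ge_atTop (-x)))).exists
  rw [← hasLaw_margin_cdf h1 h2 hX i] at hy
  exact (pos_of_mul_pos_right hy (by positivity)).trans_le (monotone_cdf _ (by linarith))

lemma copula_eq_gigMixture (h1 : -1 < ρ) (h2 : ρ < 1)
    (hX : HasLaw X (skewGH ρ !₂[θ, θ] p a b) P) (u : ℝ) :
    copula P X u u = 1 / (2 * barK p a b) *
      gigMixture p a b θ (orthantTail ρ) (-quantile (P.map fun ω => X ω 0) u) := by
  have hK := barK_pos_of_isProbabilityMeasure (isProbabilityMeasure_skewGH_of_hasLaw hX)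
  rw [copula, hasLaw_margin_eq h1 h2 hX, ← skewGH_real_orthant hK]
  simp only [neg_neg]
  exact hX.measureReal_eq (p := fun x => x 0 ≤ _ ∧ x 1 ≤ _)
    (measurableSet_setOfPred.2 (by fun_prop))

/-- This is where the measurability of L comes from. -/
lemma copula_diag_monotoneOn : MonotoneOn (fun u => copula P X u u) (Set.Ioo 0 1) := by
  intro u hu v hv huv
  exact measureReal_mono fun ω hω => ⟨hω.1.trans (quantile_mono hu.1 huv hv.2),
    hω.2.trans (quantile_mono hu.1 huv hv.2)⟩

end Margins

end

theorem mainTheorem1 {Ω : Type*} [MeasurableSpace Ω] (P : Measure Ω) [IsProbabilityMeasure P]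
    (ρ θ p a b : ℝ) (hρ : -1 < ρ) (hρ' : ρ < 1) (ha : 0 ≤ a) (hb : 0 < b) (hp : a = 0 → 0 < p)
    (X : Ω → EuclideanSpace ℝ (Fin 2)) (hX : HasLaw X (skewGH ρ !₂[θ, θ] p a b) P) :
    1 < EquiSkewGH.tau ρ θ b ∧
    ∃ L : ℝ → ℝ, SlowlyVaryingAtZero L ∧
      (∀ u ∈ Set.Ioo (0 : ℝ) 1,
        copula P X u u = u ^ EquiSkewGH.tau ρ θ b * L u ∧
        copula P X u u / u = u ^ (EquiSkewGH.tau ρ θ b - 1) * L u) ∧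
      L ~[𝓝[>] 0] fun u =>
        EquiSkewGH.const1 ρ θ p a b * EquiSkewGH.const2 ρ θ p a b *
          |Real.log u| ^ ((p - 1) * (1 - EquiSkewGH.tau ρ θ b) - 1 / 2) := by
  have hK := barK_pos_of_isProbabilityMeasure (isProbabilityMeasure_skewGH_of_hasLaw hX)
  have := hasLaw_margin_isProbabilityMeasure hX 0
  have := hasLaw_margin_nullSingletonClass hρ hρ' hX 0
  have hα := alpha_pos hρ hρ'
  have hδ := EquiSkewGH.delta_pos (θ := θ) hb
  have hA := EquiSkewGH.constA_pos (θ := θ) hb hK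
  have hβ := EquiSkewGH.beta_pos (ρ := ρ) (θ := θ) hb
  have hγ := EquiSkewGH.gamma_pos (ρ := ρ) (θ := θ) hb
  -- L is defined as the quotient, so both factorisations are algebra and the content lies in its
  -- asymptotics.
  refine ⟨EquiSkewGH.one_lt_tau hρ hρ' hb, fun u => copula P X u u / u ^ EquiSkewGH.tau ρ θ b, ?_⟩
  set τ := EquiSkewGH.tau ρ θ b with hτ
  set κ := (p - 1) * (1 - τ) - 1 / 2 with hκ
  have hC1 : 0 < EquiSkewGH.const1 ρ θ p a b := by
    rw [EquiSkewGH.const1]; positivity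
  have hC2 : 0 < EquiSkewGH.const2 ρ θ p a b := by
    rw [EquiSkewGH.const2]; positivity
  have hmain : Tendsto (fun u => copula P X u u / u ^ τ / |Real.log u| ^ κ) (𝓝[>] 0)
      (𝓝 (EquiSkewGH.const1 ρ θ p a b * EquiSkewGH.const2 ρ θ p a b)) := by
    have h := tendsto_div_rpow_of_tails (y := fun u => -quantile (P.map fun ω => X ω 0) u) hA hδ
      (EquiSkewGH.margin_tendsto hb hK) (EquiSkewGH.joint_tendsto hρ hρ' hb hK)
      (tendsto_neg_atBot_atTop.comp
        (quantile_tendsto_atBot (hasLaw_margin_cdf_pos hρ hρ' hb hX 0))) ?_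
    -- The powers δ^(p-3/2), from the joint tail, and δ^(-κ), from y ~ |log u|/δ, combine to the
    -- δ^((p-1)τ) of `const2`.
    · have hconst : EquiSkewGH.const1 ρ θ p a b * EquiSkewGH.delta θ b ^ (p - 3 / 2) *
          EquiSkewGH.constA θ p a b ^ (-τ) * EquiSkewGH.delta θ b ^ (-κ) =
          EquiSkewGH.const1 ρ θ p a b * EquiSkewGH.const2 ρ θ p a b := by
        rw [EquiSkewGH.const2, ← hτ,
          show (p - 1) * τ = (p - 3 / 2) + -κ by rw [hκ]; ring, Real.rpow_add hδ]
        ring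
      rw [← hτ, ← hκ, hconst] at h
      exact h.congr fun u => by rw [copula_eq_gigMixture hρ hρ' hX]
    · filter_upwards [Ioo_mem_nhdsGT one_pos] with u hu
      rw [← hasLaw_margin_cdf hρ hρ' hX 0, neg_neg, cdf_quantile hu.1 hu.2]
  refine ⟨slowlyVaryingAtZero_of_tendsto (mul_pos hC1 hC2) ?_ hmain, fun u hu => ?_, ?_⟩
  · have hmono : Monotone ((Set.Ioo (0 : ℝ) 1).domRestrict fun u => copula P X u u) :=
      fun u v huv => copula_diag_monotoneOn u.2 v.2 huv
    exact hmono.measurable.div (measurable_subtype_coe.pow_const τ)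
  · have hpow : u ^ τ ≠ 0 := (Real.rpow_pos_of_pos hu.1 _).ne'
    have hu0 : u ≠ 0 := hu.1.ne'
    refine ⟨by field_simp, ?_⟩
    rw [Real.rpow_sub_one hu0]
    field_simp
  · refine isEquivalent_of_tendsto_one ?_
    have h := hmain.div_const (EquiSkewGH.const1 ρ θ p a b * EquiSkewGH.const2 ρ θ p a b)
    rw [div_self (mul_pos hC1 hC2).ne'] at h
    refine h.congr fun u => ?_
    rw [Pi.div_apply, div_div, mul_comm (|Real.log u| ^ κ)]
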